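/- Let $W \ge 1$ be an integer, let $R$ be a positive integer that divides $W$, and let $0 \le K \le W$ be an integer. Index the columns by the $W$ integer frequencies $\omega$ with $-W/2 < \omega \le W/2$ (for even $W$ these are $0, \pm 1, \dots, \pm(W/2-1), W/2$). Let $F$ be the unitary $W \times W$ matrix with entries $W^{-1/2} \mathrm{e}^{-2\pi \mathrm{i} n\omega/W}$, where $n = 0, 1, \dots, W-1$. Let $D = \operatorname{diag}(\varepsilon_0, \dots, \varepsilon_{W-1})$, where the $\varepsilon_n$ are independent random variables that take the values $\pm 1$ with probability $1/2$ each. Let $H$ be the $R \times W$ matrix whose row $r$ ($r = 0, \dots, R-1$) has unit entries in the $W/R$ consecutive columns $j$ with $rW/R \le j < (r+1)W/R$, where $j = 0, \dots, W-1$, and zeros elsewhere. The random matrix $\Phi = HDF$ is called an $R \times W$ random demodulator matrix. For a set $\Omega$ of frequencies let $\Phi_\Omega$ be the submatrix of $\Phi$ that consists of the columns listed in $\Omega$, and let $\|\cdot\|$ denote the spectral norm. There is a universal constant $C > 0$ such that the following holds for all such $W$, $R$ and $K$. If $$ R \ge C\,[\,K \log W + \log^3 W\,] $$ and if $\Omega$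 is a uniformly random set of exactly $K$ frequencies, independent of $(\varepsilon_0, \dots, \varepsilon_{W-1})$, then $$ \mathbb{P}\{\, \|\Phi_\Omega^* \Phi_\Omega - \mathrm{I}\| \ge 0.5 \,\} \le 3W^{-1}. $$ -/

import Mathlib

open MeasureTheory ProbabilityTheory
open scoped Matrix Matrix.Norms.L2Operator

noncomputable section

/-- The integer frequencies `ω` with `-W/2 < ω ≤ W/2`; there are `W` of them.  For even `W` this is
`{0, ±1, …, ±(W/2 - 1), W/2}`. -/
abbrev Freq (W : ℕ) : Type := {ω : ℤ // ω ∈ Finset.Ioc ((W : ℤ) / 2 - W) ((W : ℤ) / 2)}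

/-- The (permuted) unitary discrete Fourier transform matrix
`W^{-1/2} [exp(-2πi n ω / W)]`, with `n = 0, …, W - 1` and `ω` a frequency. -/
def fourierMatrix (W : ℕ) : Matrix (Fin W) (Freq W) ℂ :=
  Matrix.of fun n ω =>
    ((1 / Real.sqrt (W : ℝ) : ℝ) : ℂ) *
      Complex.exp (-(2 * (Real.pi : ℂ) * Complex.I * ((n : ℕ) : ℂ) * ((ω : ℤ) : ℂ)) / (W : ℂ))

/-- The diagonal matrix of a chipping sequence. -/
def chippingMatrix {W : ℕ} (ε : Fin W → ℝ) : Matrix (Fin W) (Fin W) ℂ :=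
  Matrix.diagonal fun n => (ε n : ℂ)

/-- The accumulate-and-dump matrix, for `R` dividing `W`: row `r = 0, …, R - 1` has `W / R`
consecutive unit entries, in the columns `r (W / R) ≤ j < (r + 1) (W / R)` (counted from zero), and
zeros elsewhere. -/
def samplerMatrix (R W : ℕ) : Matrix (Fin R) (Fin W) ℂ :=
  Matrix.of fun r j =>
    if (r : ℕ) * (W / R) ≤ (j : ℕ) ∧ (j : ℕ) < ((r : ℕ) + 1) * (W / R) then 1 else 0

/-- The `R × W` demodulator matrix `Φ = H D F` with chipping sequence `ε`. -/
def demodulatorMatrix (R : ℕ) {W : ℕ} (ε : Fin W → ℝ) : Matrix (Fin R) (Freq W) ℂ :=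
  samplerMatrix R W * chippingMatrix ε * fourierMatrix W

/-- The column submatrix `Φ_S` of `Φ` with the columns listed in `S`. -/
def columnSubmatrix {m n : Type*} (Φ : Matrix m n ℂ) (S : Finset n) :
    Matrix m {ω : n // ω ∈ S} ℂ :=
  Φ.submatrix id Subtype.val

/-- The law of a Rademacher variable: the values `1` and `-1` have probability `1/2` each. -/
def rademacherLaw : Measure ℝ := uniformOn {1, -1}

/-- The uniform distribution on the sets of exactly `K` frequencies. -/
def uniformSubsetLaw (W K : ℕ) : Measure (Finset (Freq W)) := uniformOn {S | S.card = K}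

end

/-!
Write `G = Φᴴ Φ` for the Gram matrix of the demodulator and `p = ⌈log W⌉`. The proof replaces the
probability space by uniform counting over sign vectors and `K`-sets of frequencies, and combines
two facts.

*Coherence.* Each entry of `G - 1` is a sum over the `R` sampler blocks of independent centred
products of two Rademacher sums with variance proxy `1 / R`. Squares of Rademacher sums have
exponential moments (`sum_exp_mul_sq_le`), so a Bernstein-type argument
(`card_le_re_sum_block_le`) and a union bound show that, outside a fraction `1 / W` of the chipping
sequences, all entries of `G - 1` are at most `μ`, where `μ ^ 2` is of order `p / R`
(`card_exists_le_norm_demodulatorGram_sub_one_le`). Moreover `‖G‖ ≤ W / R` for every chipping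
sequence, because `F` and `D` are isometries and the rows of `H` are orthogonal of squared norm
`W / R`.

*Random submatrices.* For a fixed such `G`, the off-diagonal part of a random principal submatrix
is an average of blocks `G_{T,U}` with `T` and `U` disjoint (`two_pow_mul_norm_offDiagPart_pow_le`).
Selecting the columns `U` and then the rows `T` amounts to summing rank-one matrices `a aᴴ` over a
uniformly random set of indices. The trace moments of such a sum are bounded by
`sum_powersetCard_trace_pow_le`: the `p`-th moment is at most `(p L + δ Λ) ^ p` times the dimension,
where `L` is the largest squared norm, `Λ` bounds the full sum and `δ` is the sampling rate. This
rests on the elementary inequality `⟨a, (N + a aᴴ) ^ q a⟩ ≤ ⟨a, (N + ‖a‖²) ^ q a⟩` for positive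
semidefinite `N` (`quadForm_pow_add_vecMulVec_le`), which makes an induction on `p` work without
symmetrization or matrix Laplace transforms. Three applications give a `2 p`-th moment of the
off-diagonal part of order `((p ^ 3 + K p) / R) ^ p` up to powers of `W`
(`sum_norm_offDiagPart_pow_le`), and Markov's inequality with `p ≥ log W` finishes the proof.
-/

/-! ### Powers of positive semidefinite matrices -/

lemma trace_vecMulVec_mul {n : Type*} [Fintype n] (a : n → ℂ) (M : Matrix n n ℂ) :
    (Matrix.vecMulVec a (star a) * M).trace = star a ⬝ᵥ M *ᵥ a := by
  rw [Matrix.vecMulVec_mul, Matrix.trace_vecMulVec, Matrix.dotProduct_mulVec, dotProduct_comm]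

lemma quadForm_mul_vecMulVec_mul {n : Type*} [Fintype n] (a : n → ℂ) (M M' : Matrix n n ℂ) :
    star a ⬝ᵥ (M * Matrix.vecMulVec a (star a) * M') *ᵥ a =
      (star a ⬝ᵥ M *ᵥ a) * (star a ⬝ᵥ M' *ᵥ a) := by
  rw [← Matrix.mulVec_mulVec, ← Matrix.mulVec_mulVec, Matrix.vecMulVec_mulVec,
    Matrix.mulVec_smul, dotProduct_smul]
  simp

section PowerMoments

open scoped ComplexOrder

variable {n : Type*} [Fintype n] [DecidableEq n]

lemma Matrix.PosSemidef.exists_unitary_diagonal {N : Matrix n n ℂ} (hN : N.PosSemidef) :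
    ∃ (U : Matrix n n ℂ) (d : n → ℝ), Uᴴ * U = 1 ∧ U * Uᴴ = 1 ∧ (∀ k, 0 ≤ d k) ∧
      N = U * Matrix.diagonal (fun k => (d k : ℂ)) * Uᴴ := by
  have hU := hN.isHermitian.eigenvectorUnitary.2
  rw [Matrix.mem_unitaryGroup_iff] at hU
  have hU' := hN.isHermitian.eigenvectorUnitary.2
  rw [Matrix.mem_unitaryGroup_iff'] at hU'
  exact ⟨_, _, hU', hU, hN.eigenvalues_nonneg, by
    conv_lhs => rw [hN.isHermitian.spectral_theorem, Unitary.conjStarAlgAut_apply]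
    rfl⟩

lemma unitary_conj_diagonal_mul {U : Matrix n n ℂ} (hU : Uᴴ * U = 1) (d e : n → ℂ) :
    (U * Matrix.diagonal d * Uᴴ) * (U * Matrix.diagonal e * Uᴴ) =
      U * Matrix.diagonal (fun k => d k * e k) * Uᴴ := by
  calc _ = U * Matrix.diagonal d * (Uᴴ * U) * Matrix.diagonal e * Uᴴ := by
        simp only [Matrix.mul_assoc]
    _ = _ := by
        rw [hU, Matrix.mul_one, Matrix.mul_assoc U, Matrix.diagonal_mul_diagonal]

lemma unitary_conj_diagonal_pow {U : Matrix n n ℂ} (hU : Uᴴ * U = 1) (hU' : U * Uᴴ = 1)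
    (d : n → ℂ) (p : ℕ) :
    (U * Matrix.diagonal d * Uᴴ) ^ p = U * Matrix.diagonal (fun k => d k ^ p) * Uᴴ := by
  induction p with
  | zero => simp [hU']
  | succ p ih => rw [pow_succ, ih, unitary_conj_diagonal_mul hU]; simp only [pow_succ]

lemma trace_unitary_conj_diagonal {U : Matrix n n ℂ} (hU : Uᴴ * U = 1) (d : n → ℂ) :
    (U * Matrix.diagonal d * Uᴴ).trace = ∑ k, d k := by
  rw [Matrix.mul_assoc, Matrix.trace_mul_comm, Matrix.mul_assoc, hU, Matrix.mul_one,
    Matrix.trace_diagonal]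

lemma quadForm_unitary_conj_diagonal (U : Matrix n n ℂ) (d : n → ℝ) (a : n → ℂ) :
    star a ⬝ᵥ (U * Matrix.diagonal (fun k => (d k : ℂ)) * Uᴴ) *ᵥ a =
      ((∑ k, ‖(Uᴴ *ᵥ a) k‖ ^ 2 * d k : ℝ) : ℂ) := by
  rw [← Matrix.mulVec_mulVec, ← Matrix.mulVec_mulVec, Matrix.dotProduct_mulVec]
  have : star a ᵥ* U = star (Uᴴ *ᵥ a) := by
    rw [Matrix.star_mulVec, Matrix.conjTranspose_conjTranspose]
  rw [this]
  simp only [dotProduct, Matrix.mulVec_diagonal, Pi.star_apply]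
  push_cast
  refine Finset.sum_congr rfl fun k _ => ?_
  rw [← Complex.conj_mul']
  simp only [RCLike.star_def]
  ring

/-- In an eigenbasis of `N` the quadratic forms of the polynomials `N ^ j * (N + L) ^ r` at a
vector `a` are integrals against one positive measure on the spectrum. -/
lemma Matrix.PosSemidef.exists_spectral_measure {N : Matrix n n ℂ} (hN : N.PosSemidef)
    (a : n → ℂ) :
    ∃ w d : n → ℝ, (∀ k, 0 ≤ w k) ∧ (∀ k, 0 ≤ d k) ∧ ∀ (j r : ℕ) (L : ℝ),
      star a ⬝ᵥ (N ^ j * (N + (L : ℂ) • (1 : Matrix n n ℂ)) ^ r) *ᵥ a =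
        ((∑ k, w k * (d k ^ j * (d k + L) ^ r) : ℝ) : ℂ) := by
  obtain ⟨U, d, hU, hU', hd, rfl⟩ := hN.exists_unitary_diagonal
  refine ⟨fun k => ‖(Uᴴ *ᵥ a) k‖ ^ 2, d, fun k => by positivity, hd, fun j r L => ?_⟩
  have h1 : U * Matrix.diagonal (fun k => (d k : ℂ)) * Uᴴ + (L : ℂ) • (1 : Matrix n n ℂ) =
      U * Matrix.diagonal (fun k => ((d k + L : ℝ) : ℂ)) * Uᴴ := by
    have : Matrix.diagonal (fun k => ((d k + L : ℝ) : ℂ)) =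
        Matrix.diagonal (fun k => (d k : ℂ)) + (L : ℂ) • (1 : Matrix n n ℂ) := by
      rw [← Matrix.diagonal_one, ← Matrix.diagonal_smul, Matrix.diagonal_add]
      congr 1; ext k; simp
    rw [this, Matrix.mul_add, Matrix.add_mul, Matrix.mul_smul, Matrix.mul_one, Matrix.smul_mul,
      hU']
  rw [h1, unitary_conj_diagonal_pow hU hU', unitary_conj_diagonal_pow hU hU',
    unitary_conj_diagonal_mul hU, ← quadForm_unitary_conj_diagonal]
  congr 5
  ext k; push_cast; ring

lemma pow_eq_add_sum_telescope {A : Type*} [Ring A] (N B : A) (q : ℕ) :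
    B ^ q = N ^ q + ∑ j ∈ Finset.range q, N ^ j * (B - N) * B ^ (q - 1 - j) := by
  induction q with
  | zero => simp
  | succ q ih =>
    rw [Finset.sum_range_succ']
    have h1 : ∑ k ∈ Finset.range q, N ^ (k + 1) * (B - N) * B ^ (q + 1 - 1 - (k + 1)) =
        N * ∑ k ∈ Finset.range q, N ^ k * (B - N) * B ^ (q - 1 - k) := by
      rw [Finset.mul_sum]
      refine Finset.sum_congr rfl fun k _ => ?_
      rw [show q + 1 - 1 - (k + 1) = q - 1 - k by omega, pow_succ']
      simp only [mul_assoc]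
    have h2 : N * ∑ k ∈ Finset.range q, N ^ k * (B - N) * B ^ (q - 1 - k) =
        N * B ^ q - N ^ (q + 1) := by
      rw [eq_sub_iff_add_eq', pow_succ', ← mul_add, ← ih]
    rw [h1, h2]
    simp only [pow_zero, one_mul, Nat.add_sub_cancel, Nat.sub_zero, sub_mul, pow_succ' B]
    abel

/-- Chebyshev's association inequality for two increasing functions of `d`. -/
lemma sum_mul_sum_le_of_monovary {ι : Type*} [Fintype ι] (w f g : ι → ℝ) (hw : ∀ k, 0 ≤ w k)
    (h : ∀ k l, 0 ≤ (f k - f l) * (g k - g l)) :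
    (∑ k, w k * f k) * (∑ k, w k * g k) ≤ (∑ k, w k) * ∑ k, w k * (f k * g k) := by
  have h0 : 0 ≤ ∑ k, ∑ l, w k * w l * ((f k - f l) * (g k - g l)) :=
    Finset.sum_nonneg fun k _ => Finset.sum_nonneg fun l _ =>
      mul_nonneg (mul_nonneg (hw k) (hw l)) (h k l)
  have h1 : ∑ k, ∑ l, w k * w l * ((f k - f l) * (g k - g l)) =
      (∑ k, w k * (f k * g k)) * (∑ l, w l) + (∑ k, w k) * (∑ l, w l * (f l * g l))
      - (∑ k, w k * f k) * (∑ l, w l * g l) - (∑ k, w k * g k) * (∑ l, w l * f l) := by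
    simp only [Finset.sum_mul_sum, ← Finset.sum_add_distrib, ← Finset.sum_sub_distrib]
    refine Finset.sum_congr rfl fun k _ => Finset.sum_congr rfl fun l _ => by ring
  rw [h1] at h0
  nlinarith

/-- Powers are not operator monotone, but at the vector `a` itself the powers of the rank-one
perturbation `N + a aᴴ` are dominated by those of the scalar perturbation `N + L`, `L ≥ ‖a‖²`.
Expanding both sides reduces this to the association inequality for the spectral measure of `N`
at `a`. -/
lemma quadForm_pow_add_vecMulVec_le {N : Matrix n n ℂ} (hN : N.PosSemidef) (a : n → ℂ) {L : ℝ}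
    (hL : (star a ⬝ᵥ a).re ≤ L) (q : ℕ) :
    (star a ⬝ᵥ ((N + Matrix.vecMulVec a (star a)) ^ q) *ᵥ a).re ≤
      (star a ⬝ᵥ ((N + (L : ℂ) • (1 : Matrix n n ℂ)) ^ q) *ᵥ a).re := by
  obtain ⟨w, d, hw, hd, hwd⟩ := hN.exists_spectral_measure a
  have hL0 : ∑ k, w k ≤ L := by
    have := hwd 0 0 L
    simp only [pow_zero, Matrix.one_mulVec, mul_one] at this
    rw [this, Complex.ofReal_re] at hL
    exact hL
  have hLnn : 0 ≤ L := (Finset.sum_nonneg fun k _ => hw k).trans hL0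
  have hm : ∀ j, star a ⬝ᵥ (N ^ j) *ᵥ a = ((∑ k, w k * d k ^ j : ℝ) : ℂ) := fun j => by
    simpa using hwd j 0 L
  have hg : ∀ r, star a ⬝ᵥ ((N + (L : ℂ) • (1 : Matrix n n ℂ)) ^ r) *ᵥ a =
      ((∑ k, w k * (d k + L) ^ r : ℝ) : ℂ) := fun r => by simpa using hwd 0 r L
  induction q using Nat.strong_induction_on with
  | _ q ih =>
  rw [pow_eq_add_sum_telescope N (N + _) q, hg, Complex.ofReal_re, add_sub_cancel_left,
    Matrix.add_mulVec, dotProduct_add, Matrix.sum_mulVec, dotProduct_sum, Complex.add_re,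
    Complex.re_sum, hm, Complex.ofReal_re]
  have hexp : ∑ k, w k * (d k + L) ^ q = ∑ k, w k * d k ^ q +
      ∑ j ∈ Finset.range q, L * ∑ k, w k * (d k ^ j * (d k + L) ^ (q - 1 - j)) := by
    simp only [Finset.mul_sum]
    rw [Finset.sum_comm, ← Finset.sum_add_distrib]
    refine Finset.sum_congr rfl fun k _ => ?_
    rw [pow_eq_add_sum_telescope (d k) (d k + L) q, mul_add, Finset.mul_sum]
    congr 1
    refine Finset.sum_congr rfl fun j _ => by ring
  rw [hexp]
  refine add_le_add le_rfl (Finset.sum_le_sum fun j hj => ?_)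
  rw [quadForm_mul_vecMulVec_mul, hm, Complex.re_ofReal_mul]
  have hj' := Finset.mem_range.1 hj
  have h1 := ih (q - 1 - j) (by omega)
  rw [hg, Complex.ofReal_re] at h1
  have hmj : 0 ≤ ∑ k, w k * d k ^ j :=
    Finset.sum_nonneg fun k _ => mul_nonneg (hw k) (pow_nonneg (hd k) _)
  refine (mul_le_mul_of_nonneg_left h1 hmj).trans ?_
  refine (sum_mul_sum_le_of_monovary w _ _ hw fun k l => ?_).trans
    (mul_le_mul_of_nonneg_right hL0 (Finset.sum_nonneg fun k _ => mul_nonneg (hw k)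
      (mul_nonneg (pow_nonneg (hd k) _) (pow_nonneg (add_nonneg (hd k) hLnn) _))))
  rcases le_total (d k) (d l) with h | h
  · exact mul_nonneg_of_nonpos_of_nonpos
      (sub_nonpos.2 (pow_le_pow_left₀ (hd k) h _))
      (sub_nonpos.2 (pow_le_pow_left₀ (add_nonneg (hd k) hLnn) (by linarith) _))
  · exact mul_nonneg (sub_nonneg.2 (pow_le_pow_left₀ (hd l) h _))
      (sub_nonneg.2 (pow_le_pow_left₀ (add_nonneg (hd l) hLnn) (by linarith) _))

/-- If the frame operator of the vectors `a i` is at most `Λ`, then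
`∑ ⟨a i, N a i⟩ ≤ Λ tr N` for every positive semidefinite `N`. -/
lemma sum_quadForm_le_trace {ι : Type*} (s : Finset ι) (a : ι → n → ℂ) {Λ : ℝ}
    (hΛ : ∀ x : n → ℂ, ∑ i ∈ s, ‖star (a i) ⬝ᵥ x‖ ^ 2 ≤ Λ * ∑ k, ‖x k‖ ^ 2)
    {N : Matrix n n ℂ} (hN : N.PosSemidef) :
    ∑ i ∈ s, (star (a i) ⬝ᵥ N *ᵥ a i).re ≤ Λ * N.trace.re := by
  obtain ⟨U, d, hU, hU', hd, rfl⟩ := hN.exists_unitary_diagonal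
  simp only [quadForm_unitary_conj_diagonal, Complex.ofReal_re]
  have htr : (U * Matrix.diagonal (fun k => (d k : ℂ)) * Uᴴ).trace.re = ∑ k, d k := by
    rw [trace_unitary_conj_diagonal hU, Complex.re_sum]
    simp
  rw [htr, Finset.sum_comm, Finset.mul_sum]
  refine Finset.sum_le_sum fun k _ => ?_
  rw [← Finset.sum_mul]
  refine mul_le_mul_of_nonneg_right ?_ (hd k)
  have hcol : ∑ l, ‖U l k‖ ^ 2 = 1 := by
    have h := congrFun (congrFun hU k) k
    simp only [Matrix.mul_apply, Matrix.conjTranspose_apply, RCLike.star_def,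
      Complex.conj_mul', Matrix.one_apply_eq] at h
    exact_mod_cast h
  have h := hΛ (fun l => U l k)
  rw [hcol, mul_one] at h
  refine le_of_eq_of_le (Finset.sum_congr rfl fun i _ => ?_) h
  congr 1
  rw [← norm_star (star (a i) ⬝ᵥ _)]
  simp [Matrix.mulVec, dotProduct, mul_comm]

/-- For a positive semidefinite matrix, `‖B‖ ^ p ≤ tr (B ^ p)`. -/
lemma Matrix.PosSemidef.norm_pow_le_trace_pow {B : Matrix n n ℂ} (hB : B.PosSemidef) {p : ℕ}
    (hp : p ≠ 0) : ‖B‖ ^ p ≤ (B ^ p).trace.re := by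
  obtain ⟨U, d, hU, hU', hd, rfl⟩ := hB.exists_unitary_diagonal
  rw [unitary_conj_diagonal_pow hU hU', trace_unitary_conj_diagonal hU]
  have hmem : U ∈ unitary (Matrix n n ℂ) := Unitary.mem_iff.2 ⟨hU, hU'⟩
  have hnorm : ‖U * Matrix.diagonal (fun k => (d k : ℂ)) * Uᴴ‖ ≤ ‖fun k => (d k : ℂ)‖ := by
    rw [← Matrix.star_eq_conjTranspose, CStarRing.norm_mul_mem_unitary _ (Unitary.star_mem hmem),
      CStarRing.norm_mem_unitary_mul _ hmem, Matrix.l2_opNorm_diagonal]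
  refine (pow_le_pow_left₀ (norm_nonneg _) hnorm p).trans ?_
  rw [Complex.re_sum]
  have hre : ∀ k, ((d k : ℂ) ^ p).re = d k ^ p := fun k => by
    rw [← Complex.ofReal_pow, Complex.ofReal_re]
  simp only [hre]
  rcases isEmpty_or_nonempty n with h | h
  · rw [show (fun k => (d k : ℂ)) = 0 from Subsingleton.elim _ _]
    simp [hp]
  · obtain ⟨k, hk⟩ := Finite.exists_max d
    have hle : ‖fun k => (d k : ℂ)‖ ≤ d k :=
      (pi_norm_le_iff_of_nonneg (hd k)).2 fun l => by
        rw [Complex.norm_real, Real.norm_of_nonneg (hd l)]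
        exact hk l
    refine (pow_le_pow_left₀ (norm_nonneg _) hle p).trans ?_
    exact Finset.single_le_sum (f := fun k => d k ^ p) (fun k _ => pow_nonneg (hd k) p)
      (Finset.mem_univ k)

end PowerMoments

/-! ### Trace moments of randomly sampled frames -/

section Sampling

open scoped ComplexOrder

variable {ι : Type*} [DecidableEq ι]

lemma sum_powersetCard_sum_erase_le (U : Finset ι) (k : ℕ) (g : Finset ι → ι → ℝ)
    (hg : ∀ T i, 0 ≤ g T i) :
    ∑ S ∈ U.powersetCard (k + 1), ∑ i ∈ S, g (S.erase i) i ≤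
      ∑ T ∈ U.powersetCard k, ∑ i ∈ U, g T i := by
  rw [Finset.sum_sigma', Finset.sum_sigma']
  have hinj : Set.InjOn (fun x : (_ : Finset ι) × ι => (⟨x.1.erase x.2, x.2⟩ : (_ : Finset ι) × ι))
      ((U.powersetCard (k + 1)).sigma fun S => S) := by
    rintro ⟨S, i⟩ hS ⟨S', i'⟩ hS' h
    simp only [Finset.coe_sigma, Set.mem_sigma_iff, Finset.mem_coe] at hS hS'
    simp only [Sigma.mk.injEq, heq_eq_eq] at h
    obtain ⟨h1, rfl⟩ := h
    have : S = S' := by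
      rw [← Finset.insert_erase hS.2, ← Finset.insert_erase hS'.2, h1]
    rw [this]
  rw [← Finset.sum_image (f := fun x : (_ : Finset ι) × ι => g x.1 x.2) hinj]
  refine Finset.sum_le_sum_of_subset_of_nonneg ?_ fun x _ _ => hg _ _
  intro x hx
  simp only [Finset.mem_image, Finset.mem_sigma, Finset.mem_powersetCard] at hx ⊢
  obtain ⟨⟨S, i⟩, ⟨⟨hSU, hc⟩, hi⟩, rfl⟩ := hx
  exact ⟨⟨(Finset.erase_subset _ _).trans hSU, by simp [Finset.card_erase_of_mem hi, hc]⟩,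
    hSU hi⟩

lemma choose_le_mul_choose_succ {u k : ℕ} (hk : k + 1 ≤ u) {δ : ℝ}
    (hδ : ((k + 1 : ℕ) : ℝ) ≤ δ * ((u : ℝ) - (k + 1 : ℕ) + 1)) :
    (u.choose k : ℝ) ≤ δ * u.choose (k + 1) := by
  have h : (u.choose (k + 1) : ℝ) * (k + 1 : ℕ) = u.choose k * ((u : ℝ) - k) := by
    rw [← Nat.cast_sub (by omega)]
    exact_mod_cast Nat.choose_succ_right_eq u k
  have hpos : (0 : ℝ) < (u : ℝ) - k := by
    have : ((k + 1 : ℕ) : ℝ) ≤ u := by exact_mod_cast hk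
    push_cast at this; linarith
  have hδ' : ((k + 1 : ℕ) : ℝ) ≤ δ * ((u : ℝ) - k) := by
    push_cast at hδ ⊢; linarith
  refine le_of_mul_le_mul_right ?_ hpos
  rw [← h]
  calc (u.choose (k + 1) : ℝ) * (k + 1 : ℕ) ≤ u.choose (k + 1) * (δ * ((u : ℝ) - k)) :=
        mul_le_mul_of_nonneg_left hδ' (Nat.cast_nonneg _)
    _ = _ := by ring

variable {n : Type*} [Fintype n] [DecidableEq n]

/-- A matrix Rosenthal-type inequality for sampling without replacement. `L` bounds the sampled
squared norms, `Λ` the full frame operator, and `δ` is essentially the sampling rate `k / |U|`.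
Each factor of the power either keeps the shift `c`, or selects a fresh index, which costs `δ * Λ`
and raises the shift by `L`. -/
theorem sum_powersetCard_trace_pow_le (U : Finset ι) (a : ι → n → ℂ) {L Λ δ : ℝ}
    (hL0 : 0 ≤ L) (hΛ0 : 0 ≤ Λ) (hδ0 : 0 ≤ δ)
    (hL : ∀ i ∈ U, (star (a i) ⬝ᵥ a i).re ≤ L)
    (hΛ : ∀ x : n → ℂ, ∑ i ∈ U, ‖star (a i) ⬝ᵥ x‖ ^ 2 ≤ Λ * ∑ k, ‖x k‖ ^ 2) (p : ℕ) :
    ∀ (k : ℕ) (c : ℝ), 0 ≤ c → k ≤ U.card → (k : ℝ) ≤ δ * ((U.card : ℝ) - k + 1) →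
      ∑ S ∈ U.powersetCard k, (((c : ℂ) • (1 : Matrix n n ℂ) +
          ∑ i ∈ S, Matrix.vecMulVec (a i) (star (a i))) ^ p).trace.re ≤
        U.card.choose k * (Fintype.card n * (c + p * L + δ * Λ) ^ p) := by
  induction p with
  | zero => intro k c _ _ _; simp
  | succ p ih =>
    intro k c hc hk hδ
    have hpsd : ∀ (S : Finset ι) (c : ℝ), 0 ≤ c → ((c : ℂ) • (1 : Matrix n n ℂ) +
          ∑ i ∈ S, Matrix.vecMulVec (a i) (star (a i))).PosSemidef := fun S c hc =>
      (Matrix.PosSemidef.one.smul (Complex.zero_le_real.2 hc)).add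
        (Matrix.posSemidef_sum _ fun i _ => Matrix.posSemidef_vecMulVec_self_star _)
    have hstep : ∀ S : Finset ι, (((c : ℂ) • (1 : Matrix n n ℂ) +
          ∑ i ∈ S, Matrix.vecMulVec (a i) (star (a i))) ^ (p + 1)).trace.re =
        c * (((c : ℂ) • (1 : Matrix n n ℂ) +
          ∑ i ∈ S, Matrix.vecMulVec (a i) (star (a i))) ^ p).trace.re +
        ∑ i ∈ S, (star (a i) ⬝ᵥ (((c : ℂ) • (1 : Matrix n n ℂ) +
          ∑ i ∈ S, Matrix.vecMulVec (a i) (star (a i))) ^ p) *ᵥ a i).re := by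
      intro S
      rw [pow_succ', Matrix.add_mul, Matrix.trace_add, Matrix.smul_mul, Matrix.one_mul,
        Matrix.trace_smul, Finset.sum_mul, Matrix.trace_sum, Complex.add_re, smul_eq_mul,
        Complex.re_ofReal_mul, Complex.re_sum]
      simp only [trace_vecMulVec_mul]
    simp only [hstep]
    rw [Finset.sum_add_distrib, ← Finset.mul_sum]
    have hbase : 0 ≤ (c + p * L + δ * Λ) := by positivity
    have h1 := mul_le_mul_of_nonneg_left (ih k c hc hk hδ) hc
    have hmono : (c + p * L + δ * Λ) ^ p ≤ (c + (p + 1 : ℕ) * L + δ * Λ) ^ p :=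
      pow_le_pow_left₀ hbase (by push_cast; nlinarith) p
    have h2 : ∑ S ∈ U.powersetCard k, ∑ i ∈ S, (star (a i) ⬝ᵥ (((c : ℂ) • (1 : Matrix n n ℂ) +
          ∑ i ∈ S, Matrix.vecMulVec (a i) (star (a i))) ^ p) *ᵥ a i).re ≤
        δ * Λ * (U.card.choose k * (Fintype.card n * (c + (p + 1 : ℕ) * L + δ * Λ) ^ p)) := by
      rcases k with _ | k
      · simp only [Finset.powersetCard_zero, Finset.sum_singleton, Finset.sum_empty]
        positivity
      set g : Finset ι → ι → ℝ := fun T i => (star (a i) ⬝ᵥ ((((c + L : ℝ) : ℂ) •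
          (1 : Matrix n n ℂ) + ∑ i ∈ T, Matrix.vecMulVec (a i) (star (a i))) ^ p) *ᵥ a i).re
        with hg
      have hgnn : ∀ T i, 0 ≤ g T i := fun T i =>
        ((hpsd T (c + L) (by positivity)).pow p).re_dotProduct_nonneg (a i)
      calc _ ≤ ∑ S ∈ U.powersetCard (k + 1), ∑ i ∈ S, g (S.erase i) i := by
            refine Finset.sum_le_sum fun S hS => Finset.sum_le_sum fun i hi => ?_
            have := quadForm_pow_add_vecMulVec_le (hpsd (S.erase i) c hc) (a i)
              (hL i ((Finset.mem_powersetCard.1 hS).1 hi)) p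
            rw [add_assoc, Finset.sum_erase_add _ _ hi] at this
            refine this.trans (le_of_eq ?_)
            simp only [hg]
            congr 4
            push_cast
            rw [add_smul]; abel
        _ ≤ ∑ T ∈ U.powersetCard k, ∑ i ∈ U, g T i := sum_powersetCard_sum_erase_le U k g hgnn
        _ ≤ ∑ T ∈ U.powersetCard k, Λ * ((((c + L : ℝ) : ℂ) •
          (1 : Matrix n n ℂ) + ∑ i ∈ T, Matrix.vecMulVec (a i) (star (a i))) ^ p).trace.re :=
            Finset.sum_le_sum fun T _ =>
              sum_quadForm_le_trace U a hΛ ((hpsd T (c + L) (by positivity)).pow p)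
        _ ≤ Λ * (U.card.choose k * (Fintype.card n * (c + L + p * L + δ * Λ) ^ p)) := by
            rw [← Finset.mul_sum]
            refine mul_le_mul_of_nonneg_left (ih k (c + L) (by positivity) (by omega) ?_) hΛ0
            push_cast at hδ
            nlinarith
        _ ≤ Λ * ((δ * U.card.choose (k + 1)) *
              (Fintype.card n * (c + L + p * L + δ * Λ) ^ p)) := by
            gcongr
            exact choose_le_mul_choose_succ hk hδ
        _ = _ := by push_cast; ring
    calc _ ≤ c * (U.card.choose k * (Fintype.card n * (c + (p + 1 : ℕ) * L + δ * Λ) ^ p)) +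
          δ * Λ * (U.card.choose k * (Fintype.card n * (c + (p + 1 : ℕ) * L + δ * Λ) ^ p)) :=
          add_le_add (h1.trans (by gcongr)) h2
      _ = (c + δ * Λ) * (U.card.choose k *
            (Fintype.card n * (c + (p + 1 : ℕ) * L + δ * Λ) ^ p)) := by ring
      _ ≤ (c + (p + 1 : ℕ) * L + δ * Λ) * (U.card.choose k *
            (Fintype.card n * (c + (p + 1 : ℕ) * L + δ * Λ) ^ p)) := by
          refine mul_le_mul_of_nonneg_right ?_ (by positivity)
          have : 0 ≤ ((p + 1 : ℕ) : ℝ) * L := by positivity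
          linarith
      _ = _ := by ring

end Sampling

/-! ### Random principal submatrices -/

/-- Two distinct points of `S` are separated in a prescribed way by a quarter of its subsets. -/
lemma four_mul_card_filter_powerset {ι : Type*} [DecidableEq ι] {S : Finset ι} {i j : ι}
    (hi : i ∈ S) (hj : j ∈ S) (hij : i ≠ j) :
    4 * (S.powerset.filter fun T => i ∈ T ∧ j ∉ T).card = 2 ^ S.card := by
  have h : (S.powerset.filter fun T => i ∈ T ∧ j ∉ T) =
      ((S.erase i).erase j).powerset.image (insert i) := by
    ext T
    simp only [Finset.mem_filter, Finset.mem_powerset, Finset.mem_image]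
    constructor
    · rintro ⟨hTS, hiT, hjT⟩
      refine ⟨T.erase i, fun x hx => ?_, Finset.insert_erase hiT⟩
      have hx' := Finset.mem_erase.1 hx
      exact Finset.mem_erase.2 ⟨fun h => hjT (h ▸ hx'.2), Finset.mem_erase.2 ⟨hx'.1, hTS hx'.2⟩⟩
    · rintro ⟨T, hT, rfl⟩
      refine ⟨Finset.insert_subset hi fun x hx =>
        Finset.mem_of_mem_erase (Finset.mem_of_mem_erase (hT hx)), Finset.mem_insert_self _ _, ?_⟩
      rw [Finset.mem_insert, not_or]
      exact ⟨hij.symm, fun hjT => (Finset.mem_erase.1 (hT hjT)).1 rfl⟩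
  have hinj : Set.InjOn (insert i) (((S.erase i).erase j).powerset : Set (Finset ι)) := by
    intro T hT T' hT' h
    have hn : ∀ T ∈ (((S.erase i).erase j).powerset : Set (Finset ι)), i ∉ T := fun T hT hiT => by
      have := Finset.mem_powerset.1 (Finset.mem_coe.1 hT) hiT
      exact (Finset.mem_erase.1 (Finset.mem_of_mem_erase this)).1 rfl
    rw [← Finset.erase_insert (hn T hT), ← Finset.erase_insert (hn T' hT'), h]
  rw [h, Finset.card_image_of_injOn hinj, Finset.card_powerset,
    Finset.card_erase_of_mem (Finset.mem_erase.2 ⟨hij.symm, hj⟩), Finset.card_erase_of_mem hi]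
  have h2 : 2 ≤ S.card := Finset.one_lt_card.2 ⟨i, hi, j, hj, hij⟩
  obtain ⟨c, hc⟩ := Nat.exists_eq_add_of_le h2
  rw [hc, show 2 + c - 1 - 1 = c by omega, pow_add]
  norm_num

section Submatrix

open scoped ComplexOrder

variable {ι : Type*} [Fintype ι] [DecidableEq ι]

/-- The matrix `G` with all entries outside `T × U` replaced by zero. -/
def maskMatrix (T U : Finset ι) (G : Matrix ι ι ℂ) : Matrix ι ι ℂ :=
  Matrix.of fun i j => if i ∈ T ∧ j ∈ U then G i j else 0

/-- The off-diagonal part of the principal submatrix of `G` on `S`, padded with zeros. -/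
def offDiagPart (S : Finset ι) (G : Matrix ι ι ℂ) : Matrix ι ι ℂ :=
  Matrix.of fun i j => if i ∈ S ∧ j ∈ S ∧ i ≠ j then G i j else 0

lemma sum_norm_sq_mulVec_le {m n : Type*} [Fintype m] [Fintype n] [DecidableEq n]
    (M : Matrix m n ℂ) (x : n → ℂ) :
    ∑ i, ‖(M *ᵥ x) i‖ ^ 2 ≤ ‖M‖ ^ 2 * ∑ k, ‖x k‖ ^ 2 := by
  have h := Matrix.l2_opNorm_mulVec M (WithLp.toLp 2 x)
  have h2 := pow_le_pow_left₀ (norm_nonneg _) h 2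
  rw [mul_pow, EuclideanSpace.norm_sq_eq, EuclideanSpace.norm_sq_eq] at h2
  exact h2

lemma re_star_dotProduct_self {n : Type*} [Fintype n] (a : n → ℂ) :
    (star a ⬝ᵥ a).re = ∑ k, ‖a k‖ ^ 2 := by
  simp only [dotProduct, Pi.star_apply, RCLike.star_def, Complex.conj_mul', Complex.re_sum]
  refine Finset.sum_congr rfl fun k _ => ?_
  rw [← Complex.ofReal_pow, Complex.ofReal_re]

/-- The sampled columns of `maskMatrix T U G` form a sum of rank-one matrices. -/
lemma norm_maskMatrix_pow_le (T U : Finset ι) (G : Matrix ι ι ℂ) {p : ℕ} (hp : p ≠ 0) :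
    ‖maskMatrix T U G‖ ^ (2 * p) ≤ (((((0 : ℝ) : ℂ) • (1 : Matrix ι ι ℂ) +
      ∑ j ∈ U, Matrix.vecMulVec (fun i => maskMatrix T Finset.univ G i j)
        (star fun i => maskMatrix T Finset.univ G i j)) ^ p).trace.re) := by
  have h : ((0 : ℝ) : ℂ) • (1 : Matrix ι ι ℂ) +
      ∑ j ∈ U, Matrix.vecMulVec (fun i => maskMatrix T Finset.univ G i j)
        (star fun i => maskMatrix T Finset.univ G i j) =
      maskMatrix T U G * (maskMatrix T U G)ᴴ := by
    ext i k
    simp only [Complex.ofReal_zero, zero_smul, zero_add, Matrix.sum_apply, Matrix.mul_apply,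
      Matrix.vecMulVec_apply, Matrix.conjTranspose_apply, Pi.star_apply]
    rw [← Finset.sum_subset (Finset.subset_univ U)]
    · refine Finset.sum_congr rfl fun j hj => ?_
      simp [maskMatrix, hj]
    · intro j _ hj
      simp [maskMatrix, hj]
  rw [h]
  have h2 := Matrix.l2_opNorm_conjTranspose_mul_self (maskMatrix T U G)ᴴ
  rw [Matrix.conjTranspose_conjTranspose, Matrix.l2_opNorm_conjTranspose] at h2
  rw [pow_mul, sq, ← h2]
  exact (Matrix.posSemidef_self_mul_conjTranspose _).norm_pow_le_trace_pow hp

lemma sum_norm_sq_star_dotProduct_maskMatrix_le (T U : Finset ι) (G : Matrix ι ι ℂ) (x : ι → ℂ) :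
    ∑ j ∈ U, ‖(star fun i => maskMatrix T Finset.univ G i j) ⬝ᵥ x‖ ^ 2 ≤
      ‖maskMatrix T Finset.univ G‖ ^ 2 * ∑ k, ‖x k‖ ^ 2 := by
  have h := sum_norm_sq_mulVec_le (maskMatrix T Finset.univ G)ᴴ x
  rw [Matrix.l2_opNorm_conjTranspose] at h
  exact (Finset.sum_le_sum_of_subset_of_nonneg (Finset.subset_univ U)
    fun _ _ _ => by positivity).trans h

/-- The squared norm of the part of column `j` of `G` in the rows of `T`, diagonal excluded. -/
noncomputable def offDiagColumnSq (T : Finset ι) (G : Matrix ι ι ℂ) (j : ι) : ℝ :=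
  ∑ i ∈ T, ‖if i = j then 0 else G i j‖ ^ 2

variable {G : Matrix ι ι ℂ} {β γ μ δ : ℝ}

lemma sum_offDiagColumnSq_pow_le (hcol : ∀ j, ∑ i, ‖G i j‖ ^ 2 ≤ γ)
    (hμ : ∀ i j, i ≠ j → ‖G i j‖ ≤ μ) (hδ0 : 0 ≤ δ) (j : ι) (p k : ℕ)
    (hk : k ≤ Fintype.card ι) (hδ : (k : ℝ) ≤ δ * ((Fintype.card ι : ℝ) - k + 1)) :
    ∑ T ∈ (Finset.univ : Finset ι).powersetCard k, offDiagColumnSq T G j ^ p ≤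
      (Fintype.card ι).choose k * (p * μ ^ 2 + δ * γ) ^ p := by
  have hγ0 : 0 ≤ γ := (Finset.sum_nonneg fun i _ => by positivity).trans (hcol j)
  have h := sum_powersetCard_trace_pow_le (n := Unit) (Finset.univ : Finset ι)
    (fun i _ => if i = j then 0 else G i j) (L := μ ^ 2) (Λ := γ) (δ := δ) (by positivity)
    hγ0 hδ0 (fun i _ => ?_) (fun x => ?_) p k 0 le_rfl hk hδ
  · simp only [Finset.card_univ, Fintype.card_unit, Nat.cast_one, one_mul, zero_add] at h
    refine le_of_eq_of_le (Finset.sum_congr rfl fun T _ => ?_) h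
    have hM : ((0 : ℝ) : ℂ) • (1 : Matrix Unit Unit ℂ) +
        ∑ i ∈ T, Matrix.vecMulVec (fun _ : Unit => if i = j then 0 else G i j)
          (star fun _ : Unit => if i = j then 0 else G i j) =
        Matrix.diagonal fun _ => ((offDiagColumnSq T G j : ℝ) : ℂ) := by
      ext u v
      simp only [Complex.ofReal_zero, zero_smul, zero_add, Matrix.sum_apply,
        Matrix.vecMulVec_apply, Pi.star_apply, RCLike.star_def, Complex.mul_conj',
        Matrix.diagonal_apply_eq, offDiagColumnSq]
      push_cast
      rfl
    rw [hM, Matrix.diagonal_pow, Matrix.trace_diagonal]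
    simp only [Finset.univ_unique, Finset.sum_singleton, Pi.pow_apply]
    rw [← Complex.ofReal_pow, Complex.ofReal_re]
  · rw [re_star_dotProduct_self]
    simp only [Finset.univ_unique, Finset.sum_singleton]
    split_ifs with hij
    · simp; positivity
    · exact pow_le_pow_left₀ (norm_nonneg _) (hμ i j hij) 2
  · simp only [dotProduct, Finset.univ_unique, Finset.sum_singleton, Pi.star_apply, norm_mul,
      norm_star, mul_pow]
    rw [← Finset.sum_mul]
    refine mul_le_mul_of_nonneg_right ((Finset.sum_le_sum fun i _ => ?_).trans (hcol j))
      (by positivity)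
    split_ifs with hij
    · simp
    · exact le_rfl

lemma sum_norm_maskMatrix_univ_pow_le (hG : G.IsHermitian) (hcol : ∀ j, ∑ i, ‖G i j‖ ^ 2 ≤ γ)
    (hβ : ‖G‖ ≤ β) (hγ0 : 0 ≤ γ) (hδ0 : 0 ≤ δ) {p : ℕ} (hp : p ≠ 0) (k : ℕ)
    (hk : k ≤ Fintype.card ι) (hδ : (k : ℝ) ≤ δ * ((Fintype.card ι : ℝ) - k + 1)) :
    ∑ T ∈ (Finset.univ : Finset ι).powersetCard k, ‖maskMatrix T Finset.univ G‖ ^ (2 * p) ≤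
      (Fintype.card ι).choose k * (Fintype.card ι * (p * γ + δ * β ^ 2) ^ p) := by
  have hGu : maskMatrix Finset.univ Finset.univ G = G := by ext i j; simp [maskMatrix]
  have h := sum_powersetCard_trace_pow_le (Finset.univ : Finset ι)
    (fun j i => maskMatrix Finset.univ Finset.univ G i j) (L := γ) (Λ := β ^ 2) (δ := δ) hγ0
    (by positivity) hδ0 (fun j _ => ?_) (fun x => ?_) p k 0 le_rfl hk hδ
  · rw [zero_add] at h
    refine (Finset.sum_le_sum fun T _ => ?_).trans h
    refine le_of_eq_of_le ?_ (norm_maskMatrix_pow_le Finset.univ T G hp)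
    rw [← Matrix.l2_opNorm_conjTranspose (maskMatrix T Finset.univ G)]
    congr 2
    ext i j
    simp only [Matrix.conjTranspose_apply, maskMatrix, Matrix.of_apply, Finset.mem_univ, and_true,
      true_and]
    split_ifs
    · exact hG.apply i j
    · simp
  · rw [re_star_dotProduct_self, hGu]
    exact hcol j
  · refine (sum_norm_sq_star_dotProduct_maskMatrix_le Finset.univ Finset.univ G x).trans ?_
    rw [hGu]
    gcongr

/-- Both row and column selections of an off-diagonal block are controlled by the trace moment
bound: first the columns in `U ⊆ Tᶜ` given the rows `T`, then the rows `T`. -/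
lemma sum_sum_norm_maskMatrix_pow_le [Nonempty ι] (hG : G.IsHermitian)
    (hcol : ∀ j, ∑ i, ‖G i j‖ ^ 2 ≤ γ) (hμ : ∀ i j, i ≠ j → ‖G i j‖ ≤ μ)
    (hβ : ‖G‖ ≤ β) (hδ0 : 0 ≤ δ) {p : ℕ} (hp : p ≠ 0) {K : ℕ} (hK : K ≤ Fintype.card ι)
    (hδ : (K : ℝ) ≤ δ * ((Fintype.card ι : ℝ) - K + 1)) {k : ℕ} (hk : k ≤ K) :
    ∑ T ∈ (Finset.univ : Finset ι).powersetCard k, ∑ U ∈ Tᶜ.powersetCard (K - k),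
        ‖maskMatrix T U G‖ ^ (2 * p) ≤
      ((Fintype.card ι).choose k * (Fintype.card ι - k).choose (K - k) : ℕ) *
        ((Fintype.card ι : ℝ) ^ 2 * 2 ^ p *
          ((p * (p * μ ^ 2 + δ * γ)) ^ p + (δ * (p * γ + δ * β ^ 2)) ^ p)) := by
  set W := Fintype.card ι with hW
  have hγ0 : 0 ≤ γ :=
    (Finset.sum_nonneg fun i _ => by positivity).trans (hcol (Classical.arbitrary ι))
  have hkK : (k : ℝ) ≤ K := by exact_mod_cast hk
  have hδk : (k : ℝ) ≤ δ * ((W : ℝ) - k + 1) := by nlinarith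
  have hinner : ∀ T ∈ (Finset.univ : Finset ι).powersetCard k,
      ∑ U ∈ Tᶜ.powersetCard (K - k), ‖maskMatrix T U G‖ ^ (2 * p) ≤
        (W - k).choose (K - k) * (W * (2 ^ p * (p ^ p * ∑ j, offDiagColumnSq T G j ^ p +
          δ ^ p * ‖maskMatrix T Finset.univ G‖ ^ (2 * p)))) := by
    intro T hT
    have hTk := (Finset.mem_powersetCard.1 hT).2
    have hTc : Tᶜ.card = W - k := by rw [Finset.card_compl, hTk]
    have hnn : ∀ j, 0 ≤ offDiagColumnSq T G j := fun j =>
      Finset.sum_nonneg fun i _ => by positivity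
    -- `L` is the largest column of the selected rows; its `p`-th power is at most the sum over all
    -- columns.
    obtain ⟨j₀, hj₀⟩ := Finite.exists_max (offDiagColumnSq T G)
    have h := sum_powersetCard_trace_pow_le Tᶜ
      (fun j i => maskMatrix T Finset.univ G i j) (L := offDiagColumnSq T G j₀)
      (Λ := ‖maskMatrix T Finset.univ G‖ ^ 2) (δ := δ) (hnn j₀) (by positivity) hδ0
      (fun j hj => ?_) (sum_norm_sq_star_dotProduct_maskMatrix_le T Tᶜ G) p (K - k) 0 le_rfl
      (by omega) ?_
    · rw [hTc, zero_add] at h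
      refine (Finset.sum_le_sum fun U _ => norm_maskMatrix_pow_le T U G hp).trans (h.trans ?_)
      rw [← hW]
      gcongr
      refine (add_pow_le (by have := hnn j₀; positivity) (by positivity) p).trans ?_
      rw [mul_pow, mul_pow, ← pow_mul]
      gcongr
      · have := hnn j₀
        positivity
      · norm_num
      · omega
      · exact Finset.single_le_sum (f := fun j => offDiagColumnSq T G j ^ p)
          (fun j _ => pow_nonneg (hnn j) p) (Finset.mem_univ j₀)
    · refine le_trans (le_of_eq ?_) (hj₀ j)
      rw [re_star_dotProduct_self, offDiagColumnSq,
        ← Finset.sum_subset (Finset.subset_univ T)]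
      · refine Finset.sum_congr rfl fun i hi => ?_
        have hij : i ≠ j := fun h => (Finset.mem_compl.1 hj) (h ▸ hi)
        simp [maskMatrix, hi, hij]
      · intro i _ hi
        simp [maskMatrix, hi]
    · rw [hTc, Nat.cast_sub (hk.trans hK), Nat.cast_sub hk]
      have : (0 : ℝ) ≤ k := Nat.cast_nonneg k
      linarith
  refine (Finset.sum_le_sum hinner).trans ?_
  have h1 : ∑ T ∈ (Finset.univ : Finset ι).powersetCard k, ∑ j, offDiagColumnSq T G j ^ p ≤
      W * (W.choose k * (p * μ ^ 2 + δ * γ) ^ p) := by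
    rw [Finset.sum_comm]
    refine (Finset.sum_le_sum fun j _ => sum_offDiagColumnSq_pow_le hcol hμ hδ0 j p k
      (hk.trans hK) hδk).trans ?_
    simp [hW]
  have h2 := sum_norm_maskMatrix_univ_pow_le hG hcol hβ hγ0 hδ0 hp k (hk.trans hK) hδk
  simp only [← Finset.mul_sum, Finset.sum_add_distrib]
  calc _ ≤ ((W - k).choose (K - k) : ℝ) * (W * (2 ^ p *
        (p ^ p * (W * (W.choose k * (p * μ ^ 2 + δ * γ) ^ p)) +
          δ ^ p * (W.choose k * (W * (p * γ + δ * β ^ 2) ^ p))))) := by gcongr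
    _ = _ := by
      push_cast
      rw [mul_pow, mul_pow]
      ring

lemma sum_powersetCard_sum_powerset_sdiff (K : ℕ) (f : Finset ι → Finset ι → ℝ) :
    ∑ S ∈ (Finset.univ : Finset ι).powersetCard K, ∑ T ∈ S.powerset, f T (S \ T) =
      ∑ k ∈ Finset.range (K + 1), ∑ T ∈ (Finset.univ : Finset ι).powersetCard k,
        ∑ U ∈ Tᶜ.powersetCard (K - k), f T U := by
  have h1 : ∀ S ∈ (Finset.univ : Finset ι).powersetCard K, ∑ T ∈ S.powerset, f T (S \ T) =
      ∑ k ∈ Finset.range (K + 1), ∑ T ∈ S.powersetCard k, f T (S \ T) := fun S hS => by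
    rw [Finset.sum_powerset, (Finset.mem_powersetCard.1 hS).2]
  rw [Finset.sum_congr rfl h1, Finset.sum_comm]
  refine Finset.sum_congr rfl fun k hk => ?_
  have hk' : k ≤ K := Nat.lt_succ_iff.1 (Finset.mem_range.1 hk)
  rw [Finset.sum_sigma', Finset.sum_sigma']
  refine Finset.sum_bij' (fun x _ => ⟨x.2, x.1 \ x.2⟩) (fun x _ => ⟨x.1 ∪ x.2, x.1⟩) ?_ ?_ ?_ ?_ ?_
  · rintro ⟨S, T⟩ h
    simp only [Finset.mem_sigma, Finset.mem_powersetCard, Finset.subset_univ, true_and] at h ⊢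
    obtain ⟨hS, hTS, hT⟩ := h
    refine ⟨hT, fun x hx => ?_, by rw [Finset.card_sdiff_of_subset hTS, hS, hT]⟩
    exact Finset.mem_compl.2 (Finset.mem_sdiff.1 hx).2
  · rintro ⟨T, U⟩ h
    simp only [Finset.mem_sigma, Finset.mem_powersetCard, Finset.subset_univ, true_and] at h ⊢
    obtain ⟨hT, hUT, hU⟩ := h
    have hd : Disjoint T U := Finset.disjoint_left.2 fun x hx hx' =>
      (Finset.mem_compl.1 (hUT hx')) hx
    exact ⟨by rw [Finset.card_union_of_disjoint hd, hT, hU]; omega, Finset.subset_union_left, hT⟩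
  · rintro ⟨S, T⟩ h
    simp only [Finset.mem_sigma, Finset.mem_powersetCard] at h
    simp [Finset.union_sdiff_of_subset h.2.1]
  · rintro ⟨T, U⟩ h
    simp only [Finset.mem_sigma, Finset.mem_powersetCard] at h
    have hd : Disjoint T U := Finset.disjoint_left.2 fun x hx hx' =>
      (Finset.mem_compl.1 (h.2.1 hx')) hx
    simp [Finset.union_sdiff_cancel_left hd]
  · rintro ⟨S, T⟩ _
    rfl

lemma four_smul_sum_maskMatrix {ι : Type*} [DecidableEq ι] (S : Finset ι) (G : Matrix ι ι ℂ) :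
    (4 : ℂ) • ∑ T ∈ S.powerset, maskMatrix T (S \ T) G = (2 ^ S.card : ℂ) • offDiagPart S G := by
  ext i j
  simp only [Matrix.smul_apply, Matrix.sum_apply, maskMatrix, offDiagPart, Matrix.of_apply,
    smul_eq_mul]
  by_cases h : i ∈ S ∧ j ∈ S ∧ i ≠ j
  · rw [if_pos h, ← Finset.sum_filter, Finset.sum_const, nsmul_eq_mul, ← mul_assoc]
    have h2 : (S.powerset.filter fun T => i ∈ T ∧ j ∈ S \ T) =
        S.powerset.filter fun T => i ∈ T ∧ j ∉ T := by
      refine Finset.filter_congr fun T _ => ?_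
      simp [h.2.1]
    rw [h2]
    congr 1
    exact_mod_cast four_mul_card_filter_powerset h.1 h.2.1 h.2.2
  · rw [if_neg h, mul_zero, Finset.sum_eq_zero, mul_zero]
    intro T hT
    rw [if_neg]
    rintro ⟨h1, h2⟩
    have h2 := Finset.mem_sdiff.1 h2
    exact h ⟨Finset.mem_powerset.1 hT h1, h2.1, fun h => h2.2 (h ▸ h1)⟩

/-- Decoupling: the off-diagonal part is an average of blocks with disjoint row and column sets. -/
lemma two_pow_mul_norm_offDiagPart_pow_le (S : Finset ι) (G : Matrix ι ι ℂ) {q : ℕ} (hq : q ≠ 0) :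
    2 ^ S.card * ‖offDiagPart S G‖ ^ q ≤ 4 ^ q * ∑ T ∈ S.powerset, ‖maskMatrix T (S \ T) G‖ ^ q := by
  obtain ⟨q, rfl⟩ := Nat.exists_eq_succ_of_ne_zero hq
  have h1 : 2 ^ S.card * ‖offDiagPart S G‖ ≤
      4 * ∑ T ∈ S.powerset, ‖maskMatrix T (S \ T) G‖ := by
    have h := congrArg norm (four_smul_sum_maskMatrix S G)
    rw [norm_smul, norm_smul] at h
    simp only [norm_pow, RCLike.norm_ofNat] at h
    rw [← h]
    gcongr
    exact norm_sum_le _ _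
  have h2 := pow_sum_div_card_le_sum_pow (s := S.powerset)
    (f := fun T => ‖maskMatrix T (S \ T) G‖) (fun _ _ => norm_nonneg _) q
  rw [Finset.card_powerset, div_le_iff₀ (by positivity)] at h2
  push_cast at h2
  have h3 := pow_le_pow_left₀ (by positivity) h1 (q + 1)
  rw [mul_pow, mul_pow] at h3
  have hpos : (0 : ℝ) < ((2 : ℝ) ^ S.card) ^ q := by positivity
  refine le_of_mul_le_mul_right ?_ hpos
  calc _ = ((2 : ℝ) ^ S.card) ^ (q + 1) * ‖offDiagPart S G‖ ^ (q + 1) := by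
        rw [Nat.succ_eq_add_one]; ring
    _ ≤ _ := h3
    _ ≤ 4 ^ (q + 1) * ((∑ T ∈ S.powerset, ‖maskMatrix T (S \ T) G‖ ^ (q + 1)) *
        ((2 : ℝ) ^ S.card) ^ q) := by gcongr
    _ = _ := by rw [Nat.succ_eq_add_one]; ring

/-- Moments of a uniformly random `K × K` principal submatrix of a Hermitian matrix, in terms of
its largest off-diagonal entry, its column norms and its operator norm. -/
theorem sum_norm_offDiagPart_pow_le [Nonempty ι] (hG : G.IsHermitian)
    (hcol : ∀ j, ∑ i, ‖G i j‖ ^ 2 ≤ γ) (hμ : ∀ i j, i ≠ j → ‖G i j‖ ≤ μ)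
    (hβ : ‖G‖ ≤ β) (hδ0 : 0 ≤ δ) {p : ℕ} (hp : p ≠ 0) {K : ℕ} (hK : K ≤ Fintype.card ι)
    (hδ : (K : ℝ) ≤ δ * ((Fintype.card ι : ℝ) - K + 1)) :
    ∑ S ∈ (Finset.univ : Finset ι).powersetCard K, ‖offDiagPart S G‖ ^ (2 * p) ≤
      (Fintype.card ι).choose K * (32 ^ p * (Fintype.card ι : ℝ) ^ 2 *
          ((p * (p * μ ^ 2 + δ * γ)) ^ p + (δ * (p * γ + δ * β ^ 2)) ^ p)) := by
  set W := Fintype.card ι with hW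
  have hpos : (0 : ℝ) < 2 ^ K := by positivity
  refine le_of_mul_le_mul_left ?_ hpos
  set B := ((W : ℝ) ^ 2 * 2 ^ p *
          ((p * (p * μ ^ 2 + δ * γ)) ^ p + (δ * (p * γ + δ * β ^ 2)) ^ p)) with hB
  have hbinom : (∑ k ∈ Finset.range (K + 1), (W.choose k * (W - k).choose (K - k) : ℕ) : ℝ) =
      2 ^ K * W.choose K := by
    have h : ∑ k ∈ Finset.range (K + 1), W.choose k * (W - k).choose (K - k) =
        2 ^ K * W.choose K := by
      rw [← Nat.sum_range_choose, Finset.sum_mul]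
      refine Finset.sum_congr rfl fun k hk => ?_
      have hk' : k ≤ K := Nat.lt_succ_iff.1 (Finset.mem_range.1 hk)
      rw [← Nat.choose_mul hk', mul_comm]
    exact_mod_cast h
  calc _ = ∑ S ∈ (Finset.univ : Finset ι).powersetCard K,
        2 ^ S.card * ‖offDiagPart S G‖ ^ (2 * p) := by
        rw [Finset.mul_sum]
        refine Finset.sum_congr rfl fun S hS => ?_
        rw [(Finset.mem_powersetCard.1 hS).2]
    _ ≤ ∑ S ∈ (Finset.univ : Finset ι).powersetCard K,
        4 ^ (2 * p) * ∑ T ∈ S.powerset, ‖maskMatrix T (S \ T) G‖ ^ (2 * p) :=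
        Finset.sum_le_sum fun S _ => two_pow_mul_norm_offDiagPart_pow_le S G (by omega)
    _ = 4 ^ (2 * p) * ∑ k ∈ Finset.range (K + 1),
          ∑ T ∈ (Finset.univ : Finset ι).powersetCard k, ∑ U ∈ Tᶜ.powersetCard (K - k),
            ‖maskMatrix T U G‖ ^ (2 * p) := by
        rw [← Finset.mul_sum,
          sum_powersetCard_sum_powerset_sdiff K fun T U => ‖maskMatrix T U G‖ ^ (2 * p)]
    _ ≤ 4 ^ (2 * p) * ∑ k ∈ Finset.range (K + 1),
          ((W.choose k * (W - k).choose (K - k) : ℕ) : ℝ) * B := by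
        gcongr with k hk
        exact sum_sum_norm_maskMatrix_pow_le hG hcol hμ hβ hδ0 hp hK hδ
          (Nat.lt_succ_iff.1 (Finset.mem_range.1 hk))
    _ = _ := by
        have h32 : (32 : ℝ) ^ p = 4 ^ (2 * p) * 2 ^ p := by
          rw [pow_mul, ← mul_pow]; norm_num
        rw [← Finset.sum_mul, hbinom, hB, h32]
        ring

end Submatrix

/-! ### Exponential moments of Rademacher sums and products -/

section Rademacher

lemma sum_units_int (f : ℤˣ → ℝ) : ∑ u, f u = f 1 + f (-1) := by
  rw [UnitsInt.univ, Finset.sum_pair (by decide)]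

/-- The exponential square moment of a Rademacher sum, shifted by `a` to make the induction over
the number of signs work. -/
lemma sum_exp_mul_sq_le (n : ℕ) : ∀ (c : Fin n → ℝ) (s a : ℝ), 0 ≤ s →
    2 * s * ∑ j, c j ^ 2 < 1 →
    ∑ e : Fin n → ℤˣ, Real.exp (s * (a + ∑ j, c j * (e j : ℤ)) ^ 2) ≤
      2 ^ n * Real.exp (s * (a ^ 2 + ∑ j, c j ^ 2) / (1 - 2 * s * ∑ j, c j ^ 2)) := by
  induction n with
  | zero => intro c s a _ _; simp
  | succ n ih =>
    intro c s a hs hlt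
    rw [← (Fin.consEquiv fun _ : Fin (n + 1) => ℤˣ).sum_comp, Fintype.sum_prod_type]
    simp only [Fin.sum_univ_succ] at hlt ⊢
    simp only [Fin.consEquiv_apply, Fin.cons_zero, Fin.cons_succ, ← add_assoc]
    set σ := ∑ j : Fin n, c j.succ ^ 2 with hσ
    set b := c 0 with hb
    have hσ0 : 0 ≤ σ := Finset.sum_nonneg fun _ _ => sq_nonneg _
    have hsσ : 0 ≤ s * σ := mul_nonneg hs hσ0
    have hsb : 0 ≤ s * b ^ 2 := mul_nonneg hs (sq_nonneg _)
    have hpos : 0 < 1 - 2 * s * (b ^ 2 + σ) := by linarith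
    have hpos' : 0 < 1 - 2 * s * σ := by nlinarith
    have h1 : ∀ u : ℤˣ, ∑ e : Fin n → ℤˣ,
        Real.exp (s * (a + b * (u : ℤ) + ∑ j, c j.succ * (e j : ℤ)) ^ 2) ≤
        2 ^ n * Real.exp (s * ((a + b * (u : ℤ)) ^ 2 + σ) / (1 - 2 * s * σ)) :=
      fun u => ih (fun j => c j.succ) s (a + b * (u : ℤ)) hs (by linarith)
    refine (Finset.sum_le_sum fun u _ => h1 u).trans ?_
    rw [← Finset.mul_sum, sum_units_int]
    set s' := s / (1 - 2 * s * σ) with hs'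
    have hs'0 : 0 ≤ s' := div_nonneg hs hpos'.le
    have hss : s = s' * (1 - 2 * s * σ) := (div_mul_cancel₀ _ hpos'.ne').symm
    have hdiv : ∀ X, s * X / (1 - 2 * s * σ) = s' * X := fun X => by rw [hs']; ring
    clear_value s'
    have h2 : Real.exp (s * ((a + b * ((1 : ℤˣ) : ℤ)) ^ 2 + σ) / (1 - 2 * s * σ)) +
        Real.exp (s * ((a + b * ((-1 : ℤˣ) : ℤ)) ^ 2 + σ) / (1 - 2 * s * σ)) =
        2 * (Real.exp (s' * (a ^ 2 + b ^ 2 + σ)) * Real.cosh (2 * s' * a * b)) := by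
      have e0 : ∀ x y z : ℝ, 2 * (x * ((y + z) / 2)) = x * y + x * z := fun x y z => by ring
      rw [hdiv, hdiv, Real.cosh_eq, e0, ← Real.exp_add, ← Real.exp_add]
      congr 2
      · simp only [Units.val_one, Int.cast_one]; ring
      · simp only [Units.val_neg, Units.val_one, Int.cast_neg, Int.cast_one]; ring
    rw [h2, pow_succ (2 : ℝ) n]
    have hcosh := Real.cosh_le_exp_half_sq (2 * s' * a * b)
    have h3 : s' * (a ^ 2 + b ^ 2 + σ) + (2 * s' * a * b) ^ 2 / 2 ≤
        s * (a ^ 2 + b ^ 2 + σ) / (1 - 2 * s * (b ^ 2 + σ)) := by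
      have hkey : s' * (1 + 2 * s' * b ^ 2) ≤ s / (1 - 2 * s * (b ^ 2 + σ)) := by
        rw [le_div_iff₀ hpos]
        have e1 : 1 - 2 * s * (b ^ 2 + σ) = (1 - 2 * s * σ) * (1 - 2 * s' * b ^ 2) := by
          linear_combination (-2 * b ^ 2) * hss
        rw [e1]
        have : s' * (1 + 2 * s' * b ^ 2) * ((1 - 2 * s * σ) * (1 - 2 * s' * b ^ 2)) =
          s' * (1 - 2 * s * σ) * (1 - (2 * s' * b ^ 2) ^ 2) := by ring
        rw [this, ← hss]
        nlinarith [sq_nonneg (2 * s' * b ^ 2)]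
      have hq : 0 ≤ a ^ 2 + b ^ 2 + σ := by positivity
      have h4 := mul_le_mul_of_nonneg_right hkey hq
      rw [div_mul_eq_mul_div] at h4
      refine le_trans ?_ h4
      nlinarith [mul_nonneg (mul_nonneg hs'0 hs'0) (mul_nonneg (sq_nonneg b)
        (add_nonneg (sq_nonneg b) hσ0))]
    have h5 : Real.exp (s' * (a ^ 2 + b ^ 2 + σ)) * Real.cosh (2 * s' * a * b) ≤
        Real.exp (s * (a ^ 2 + b ^ 2 + σ) / (1 - 2 * s * (b ^ 2 + σ))) :=
      calc _ ≤ Real.exp (s' * (a ^ 2 + b ^ 2 + σ)) * Real.exp ((2 * s' * a * b) ^ 2 / 2) := by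
            gcongr
        _ = Real.exp (s' * (a ^ 2 + b ^ 2 + σ) + (2 * s' * a * b) ^ 2 / 2) :=
            (Real.exp_add _ _).symm
        _ ≤ _ := Real.exp_le_exp.2 h3
    calc _ ≤ 2 ^ n * (2 * Real.exp (s * (a ^ 2 + b ^ 2 + σ) / (1 - 2 * s * (b ^ 2 + σ)))) := by
          gcongr
      _ = _ := by ring

/-- The Rademacher sum with complex coefficients `f` and signs `e`. -/
def rademacherSum {n : ℕ} (f : Fin n → ℂ) (e : Fin n → ℤˣ) : ℂ := ∑ j, f j * ((e j : ℤ) : ℂ)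

variable {n : ℕ}

lemma sum_exp_norm_sq_rademacherSum_le (f : Fin n → ℂ) {N : ℝ} (hN : 0 ≤ N)
    (hf : N * ∑ j, ‖f j‖ ^ 2 ≤ 1) :
    ∑ e : Fin n → ℤˣ, Real.exp (N / 8 * ‖rademacherSum f e‖ ^ 2) ≤ 2 ^ n * Real.exp (1 / 2) := by
  have key : ∀ c : Fin n → ℝ, (∀ j, c j ^ 2 ≤ ‖f j‖ ^ 2) →
      ∑ e : Fin n → ℤˣ, Real.exp (N / 4 * (∑ j, c j * (e j : ℤ)) ^ 2) ≤
        2 ^ n * Real.exp (1 / 2) := by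
    intro c hc
    have hσ : N * ∑ j, c j ^ 2 ≤ 1 :=
      (mul_le_mul_of_nonneg_left (Finset.sum_le_sum fun j _ => hc j) hN).trans hf
    have h := sum_exp_mul_sq_le n c (N / 4) 0 (by positivity) (by linarith)
    simp only [zero_add] at h
    refine h.trans (mul_le_mul_of_nonneg_left (Real.exp_le_exp.2 ?_) (by positivity))
    rw [div_le_iff₀ (by linarith)]
    linarith
  have hre := key (fun j => (f j).re) fun j => by
    rw [Complex.sq_norm, Complex.normSq_apply]; nlinarith [sq_nonneg (f j).im]
  have him := key (fun j => (f j).im) fun j => by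
    rw [Complex.sq_norm, Complex.normSq_apply]; nlinarith [sq_nonneg (f j).re]
  have hpt : ∀ e : Fin n → ℤˣ, Real.exp (N / 8 * ‖rademacherSum f e‖ ^ 2) ≤
      (Real.exp (N / 4 * (∑ j, (f j).re * (e j : ℤ)) ^ 2) +
        Real.exp (N / 4 * (∑ j, (f j).im * (e j : ℤ)) ^ 2)) / 2 := by
    intro e
    have h1 : (rademacherSum f e).re = ∑ j, (f j).re * (e j : ℤ) := by
      simp [rademacherSum, Complex.re_sum]
    have h2 : (rademacherSum f e).im = ∑ j, (f j).im * (e j : ℤ) := by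
      simp [rademacherSum, Complex.im_sum]
    rw [← h1, ← h2, Complex.sq_norm, Complex.normSq_apply]
    set u := (rademacherSum f e).re
    set v := (rademacherSum f e).im
    have e1 : Real.exp (N / 8 * (u * u + v * v)) =
        Real.exp (N / 8 * u ^ 2) * Real.exp (N / 8 * v ^ 2) := by
      rw [← Real.exp_add]; congr 1; ring
    have e2 : ∀ w : ℝ, Real.exp (N / 4 * w ^ 2) = Real.exp (N / 8 * w ^ 2) ^ 2 := fun w => by
      rw [← Real.exp_nat_mul]; congr 1; push_cast; ring
    rw [e1, e2, e2]
    nlinarith [sq_nonneg (Real.exp (N / 8 * u ^ 2) - Real.exp (N / 8 * v ^ 2))]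
  refine (Finset.sum_le_sum fun e _ => hpt e).trans ?_
  rw [← Finset.sum_div, Finset.sum_add_distrib]
  linarith

/-- Flipping the sign at `j` shows that distinct signs are uncorrelated. -/
lemma sum_sign_mul_sign {j k : Fin n} (hjk : j ≠ k) :
    ∑ e : Fin n → ℤˣ, ((e j : ℤ) : ℂ) * ((e k : ℤ) : ℂ) = 0 := by
  have h := Equiv.sum_comp (Equiv.mulLeft (Pi.mulSingle j (-1) : Fin n → ℤˣ))
    fun e : Fin n → ℤˣ => ((e j : ℤ) : ℂ) * ((e k : ℤ) : ℂ)
  simp only [Equiv.coe_mulLeft, Pi.mul_apply, Pi.mulSingle_eq_same,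
    Pi.mulSingle_eq_of_ne hjk.symm, one_mul, Units.val_neg, neg_mul, Int.cast_neg,
    Finset.sum_neg_distrib] at h
  exact self_eq_neg.1 h.symm

lemma units_int_cast_mul_self (u : ℤˣ) : ((u : ℤ) : ℂ) * ((u : ℤ) : ℂ) = 1 := by
  rcases Int.units_eq_one_or u with rfl | rfl <;> simp

lemma sum_conj_rademacherSum_mul (f g : Fin n → ℂ) :
    ∑ e : Fin n → ℤˣ, star (rademacherSum f e) * rademacherSum g e =
      2 ^ n * ∑ j, star (f j) * g j := by
  have h : ∀ e : Fin n → ℤˣ, star (rademacherSum f e) * rademacherSum g e =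
      ∑ j, ∑ k, star (f j) * g k * (((e j : ℤ) : ℂ) * ((e k : ℤ) : ℂ)) := fun e => by
    simp only [rademacherSum, star_sum, star_mul', Finset.sum_mul_sum]
    refine Finset.sum_congr rfl fun j _ => Finset.sum_congr rfl fun k _ => ?_
    simp only [RCLike.star_def, map_intCast]
    ring
  simp only [h]
  rw [Finset.sum_comm, Finset.mul_sum]
  refine Finset.sum_congr rfl fun j _ => ?_
  rw [Finset.sum_comm, Finset.sum_eq_single j]
  · simp only [units_int_cast_mul_self, mul_one, Finset.sum_const, Finset.card_univ,
      Fintype.card_pi, Fintype.card_units_int, Finset.prod_const, Fintype.card_fin, nsmul_eq_mul]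
    push_cast; ring
  · intro k _ hk
    rw [← Finset.mul_sum, sum_sign_mul_sign hk.symm, mul_zero]
  · simp

lemma exp_le_one_add_add_sq_mul_exp_abs (y : ℝ) :
    Real.exp y ≤ 1 + y + y ^ 2 * Real.exp |y| := by
  have h1 : 1 ≤ Real.exp |y| := Real.one_le_exp (abs_nonneg y)
  rcases le_or_gt |y| 1 with h | h
  · have := (abs_le.1 (Real.abs_exp_sub_one_sub_id_le h)).2
    nlinarith [sq_nonneg y]
  · rcases le_total 0 y with hy | hy
    · rw [abs_of_nonneg hy] at h h1 ⊢
      nlinarith [Real.exp_pos y, mul_self_nonneg (y - 1)]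
    · have h2 : Real.exp y ≤ 1 := Real.exp_le_one_iff.2 hy
      rw [abs_of_nonpos hy] at h h1 ⊢
      nlinarith [sq_nonneg y]

/-- A centred variable with a bounded exponential moment has a sub-Gaussian Laplace transform near
the origin. -/
lemma sum_exp_mul_le_of_sum_eq_zero {Ω : Type*} [Fintype Ω] (q : Ω → ℝ) {M x : ℝ}
    (h0 : ∑ e, q e = 0) (hM : ∑ e, Real.exp |q e| ≤ Fintype.card Ω * M) (hx0 : 0 ≤ x)
    (hx : x ≤ 1 / 2) :
    ∑ e, Real.exp (x * q e) ≤ Fintype.card Ω * Real.exp (8 * M * x ^ 2) := by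
  have hpt : ∀ e, Real.exp (x * q e) ≤ 1 + x * q e + 8 * x ^ 2 * Real.exp |q e| := by
    intro e
    refine (exp_le_one_add_add_sq_mul_exp_abs _).trans ?_
    set y := |q e| with hy
    have hy0 : 0 ≤ y := abs_nonneg _
    have h1 := Real.quadratic_le_exp_of_nonneg (by positivity : 0 ≤ y / 2)
    have h2 : Real.exp |x * q e| ≤ Real.exp (y / 2) := by
      rw [abs_mul, abs_of_nonneg hx0]
      exact Real.exp_le_exp.2 (by nlinarith)
    have h3 : Real.exp y = Real.exp (y / 2) * Real.exp (y / 2) := by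
      rw [← Real.exp_add]; congr 1; ring
    have h4 : (x * q e) ^ 2 = x ^ 2 * y ^ 2 := by rw [mul_pow, hy, sq_abs]
    rw [h4, h3]
    have h5 : y ^ 2 ≤ 8 * Real.exp (y / 2) := by nlinarith
    have h6 : x ^ 2 * y ^ 2 * Real.exp |x * q e| ≤
        x ^ 2 * (8 * Real.exp (y / 2)) * Real.exp (y / 2) := by gcongr
    linarith
  calc _ ≤ ∑ e, (1 + x * q e + 8 * x ^ 2 * Real.exp |q e|) := Finset.sum_le_sum fun e _ => hpt e
    _ = Fintype.card Ω + 8 * x ^ 2 * ∑ e, Real.exp |q e| := by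
        rw [Finset.sum_add_distrib, Finset.sum_add_distrib, ← Finset.mul_sum, ← Finset.mul_sum, h0]
        simp
    _ ≤ Fintype.card Ω + 8 * x ^ 2 * (Fintype.card Ω * M) := by gcongr
    _ = Fintype.card Ω * (8 * M * x ^ 2 + 1) := by ring
    _ ≤ _ := mul_le_mul_of_nonneg_left (Real.add_one_le_exp _) (Nat.cast_nonneg _)

/-- The Laplace transform of one block of the chaos: the product of two Rademacher sums, centred and
normalized by the inverse `N` of its variance proxy, is dominated by the squares of its factors, so
that it has a bounded exponential moment. -/
lemma sum_exp_mul_block_le (f g : Fin n → ℂ) {N x : ℝ} (hN : 0 ≤ N)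
    (hf : N * ∑ j, ‖f j‖ ^ 2 ≤ 1) (hg : N * ∑ j, ‖g j‖ ^ 2 ≤ 1) {ζ : ℂ} (hζ : ‖ζ‖ ≤ 1)
    (hx0 : 0 ≤ x) (hx : x ≤ 1 / 2) :
    ∑ e : Fin n → ℤˣ, Real.exp (x * (N / 8 *
      (ζ * (star (rademacherSum f e) * rademacherSum g e - ∑ j, star (f j) * g j)).re)) ≤
      2 ^ n * Real.exp (24 * x ^ 2) := by
  have hcard : (Fintype.card (Fin n → ℤˣ) : ℝ) = 2 ^ n := by simp
  have h := sum_exp_mul_le_of_sum_eq_zero (Ω := Fin n → ℤˣ) (fun e => N / 8 *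
      (ζ * (star (rademacherSum f e) * rademacherSum g e - ∑ j, star (f j) * g j)).re)
      (M := 3) (x := x) ?_ ?_ hx0 hx
  · rw [hcard] at h
    refine h.trans (le_of_eq ?_)
    norm_num
  · rw [← Finset.mul_sum, ← Complex.re_sum, ← Finset.mul_sum, Finset.sum_sub_distrib,
      sum_conj_rademacherSum_mul]
    simp
  · have hm : N * ‖∑ j, star (f j) * g j‖ ≤ 1 := by
      calc N * ‖∑ j, star (f j) * g j‖ ≤ N * ∑ j, (‖f j‖ ^ 2 + ‖g j‖ ^ 2) / 2 := by
            refine mul_le_mul_of_nonneg_left ((norm_sum_le _ _).trans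
              (Finset.sum_le_sum fun j _ => ?_)) hN
            rw [norm_mul, norm_star]
            nlinarith [sq_nonneg (‖f j‖ - ‖g j‖)]
        _ = (N * ∑ j, ‖f j‖ ^ 2 + N * ∑ j, ‖g j‖ ^ 2) / 2 := by
            rw [← Finset.sum_div, Finset.sum_add_distrib]; ring
        _ ≤ 1 := by linarith
    have hpt : ∀ e : Fin n → ℤˣ, Real.exp |N / 8 *
        (ζ * (star (rademacherSum f e) * rademacherSum g e - ∑ j, star (f j) * g j)).re| ≤
        Real.exp (1 / 8) * ((Real.exp (N / 8 * ‖rademacherSum f e‖ ^ 2) +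
          Real.exp (N / 8 * ‖rademacherSum g e‖ ^ 2)) / 2) := by
      intro e
      set y := ‖rademacherSum f e‖ with hy
      set z := ‖rademacherSum g e‖ with hz
      have h1 : |(ζ * (star (rademacherSum f e) * rademacherSum g e -
          ∑ j, star (f j) * g j)).re| ≤ y * z + ‖∑ j, star (f j) * g j‖ := by
        refine (Complex.abs_re_le_norm _).trans ?_
        rw [norm_mul]
        refine (mul_le_of_le_one_left (norm_nonneg _) hζ).trans ((norm_sub_le _ _).trans ?_)
        rw [norm_mul, norm_star]
      have h2 : |N / 8 * (ζ * (star (rademacherSum f e) * rademacherSum g e -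
          ∑ j, star (f j) * g j)).re| ≤ 1 / 8 + (N / 16 * y ^ 2 + N / 16 * z ^ 2) := by
        rw [abs_mul, abs_of_nonneg (by positivity : 0 ≤ N / 8)]
        refine (mul_le_mul_of_nonneg_left h1 (by positivity)).trans ?_
        nlinarith [mul_nonneg hN (sq_nonneg (y - z))]
      refine (Real.exp_le_exp.2 h2).trans ?_
      rw [Real.exp_add, Real.exp_add]
      refine mul_le_mul_of_nonneg_left ?_ (Real.exp_pos _).le
      have e2 : ∀ w : ℝ, Real.exp (N / 8 * w ^ 2) = Real.exp (N / 16 * w ^ 2) ^ 2 := fun w => by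
        rw [← Real.exp_nat_mul]; congr 1; push_cast; ring
      rw [e2, e2]
      nlinarith [sq_nonneg (Real.exp (N / 16 * y ^ 2) - Real.exp (N / 16 * z ^ 2))]
    refine (Finset.sum_le_sum fun e _ => hpt e).trans ?_
    rw [← Finset.mul_sum, ← Finset.sum_div, Finset.sum_add_distrib, hcard]
    have h1 := sum_exp_norm_sq_rademacherSum_le f hN hf
    have h2 := sum_exp_norm_sq_rademacherSum_le g hN hg
    calc _ ≤ Real.exp (1 / 8) * ((2 ^ n * Real.exp (1 / 2) + 2 ^ n * Real.exp (1 / 2)) / 2) := by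
          gcongr
      _ = 2 ^ n * Real.exp (1 / 8 + 1 / 2) := by rw [Real.exp_add]; ring
      _ ≤ 2 ^ n * Real.exp 1 := by gcongr; norm_num
      _ ≤ 2 ^ n * 3 := by
          have := Real.exp_one_lt_d9
          gcongr; linarith

/-- Bernstein-type tail bound for a sum of `R` independent blocks of a Rademacher chaos. -/
theorem card_le_re_sum_block_le {R : ℕ} (f g : Fin R → Fin n → ℂ)
    (hf : ∀ r, (R : ℝ) * ∑ j, ‖f r j‖ ^ 2 ≤ 1) (hg : ∀ r, (R : ℝ) * ∑ j, ‖g r j‖ ^ 2 ≤ 1)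
    {ζ : ℂ} (hζ : ‖ζ‖ ≤ 1) {t : ℝ} (ht0 : 0 ≤ t) (ht : t ≤ 1) :
    ((Finset.univ.filter fun e : Fin R → Fin n → ℤˣ => t ≤
      (ζ * ∑ r, (star (rademacherSum (f r) (e r)) * rademacherSum (g r) (e r) -
        ∑ j, star (f r j) * g r j)).re).card : ℝ) ≤
      2 ^ (R * n) * Real.exp (-(R * t ^ 2 / 6144)) := by
  set h : (Fin R → Fin n → ℤˣ) → ℝ := fun e =>
    (ζ * ∑ r, (star (rademacherSum (f r) (e r)) * rademacherSum (g r) (e r) -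
        ∑ j, star (f r j) * g r j)).re with hh
  -- This minimizes the Chernoff exponent `24 * x ^ 2 - x * t / 8`.
  set x : ℝ := t / 384 with hx
  have hsum : ∑ e, Real.exp (x * (R / 8 * h e)) ≤ 2 ^ (R * n) * Real.exp (R * (24 * x ^ 2)) := by
    have e1 : ∀ e, Real.exp (x * (R / 8 * h e)) = ∏ r, Real.exp (x * (R / 8 *
        (ζ * (star (rademacherSum (f r) (e r)) * rademacherSum (g r) (e r) -
          ∑ j, star (f r j) * g r j)).re)) := fun e => by
      rw [← Real.exp_sum, ← Finset.mul_sum, ← Finset.mul_sum, hh]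
      simp only [Finset.mul_sum, Complex.re_sum]
    simp only [e1]
    have e2 := (Finset.prod_univ_sum (fun _ : Fin R => (Finset.univ : Finset (Fin n → ℤˣ)))
      fun r e => Real.exp (x * (R / 8 *
        (ζ * (star (rademacherSum (f r) e) * rademacherSum (g r) e -
          ∑ j, star (f r j) * g r j)).re))).symm
    rw [Fintype.piFinset_univ] at e2
    rw [e2]
    calc _ ≤ ∏ _r : Fin R, ((2 : ℝ) ^ n * Real.exp (24 * x ^ 2)) :=
          Finset.prod_le_prod (fun r _ => Finset.sum_nonneg fun e _ => (Real.exp_pos _).le)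
            fun r _ => sum_exp_mul_block_le (f r) (g r) (Nat.cast_nonneg R) (hf r) (hg r) hζ
              (by positivity) (by rw [hx]; linarith)
      _ = _ := by
          rw [Finset.prod_const, Finset.card_univ, Fintype.card_fin, mul_pow, ← pow_mul,
            ← Real.exp_nat_mul, mul_comm n R]
  have hcheb : ((Finset.univ.filter fun e => t ≤ h e).card : ℝ) * Real.exp (x * (R / 8 * t)) ≤
      ∑ e, Real.exp (x * (R / 8 * h e)) := by
    rw [← nsmul_eq_mul]
    refine (Finset.card_nsmul_le_sum _ (fun e => Real.exp (x * (R / 8 * h e))) _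
      fun e he => Real.exp_le_exp.2 ?_).trans
      (Finset.sum_le_sum_of_subset_of_nonneg (Finset.subset_univ _) fun _ _ _ =>
        (Real.exp_pos _).le)
    have := (Finset.mem_filter.1 he).2
    gcongr
  refine le_of_mul_le_mul_right (hcheb.trans (hsum.trans (le_of_eq ?_))) (Real.exp_pos _)
  rw [mul_assoc, ← Real.exp_add]
  congr 2
  rw [hx]; ring

end Rademacher

/-! ### The Gram matrix of the random demodulator -/

section Demodulator

lemma card_freq (W : ℕ) : Fintype.card (Freq W) = W := by
  rw [Fintype.card_coe, Int.card_Ioc]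
  omega

lemma norm_fourierMatrix_apply {W : ℕ} (n : Fin W) (ω : Freq W) :
    ‖fourierMatrix W n ω‖ ^ 2 = 1 / (W : ℝ) := by
  have h : -(2 * (Real.pi : ℂ) * Complex.I * ((n : ℕ) : ℂ) * ((ω : ℤ) : ℂ)) / (W : ℂ) =
      ((-(2 * Real.pi * (n : ℕ) * (ω : ℤ)) / W : ℝ) : ℂ) * Complex.I := by push_cast; ring
  rw [fourierMatrix, Matrix.of_apply, h, norm_mul, Complex.norm_exp_ofReal_mul_I, mul_one,
    Complex.norm_real, Real.norm_of_nonneg (by positivity), div_pow, one_pow,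
    Real.sq_sqrt (Nat.cast_nonneg W)]

/-- The discrete Fourier matrix has orthonormal columns, since two distinct frequencies differ by
less than `W`. -/
lemma fourierMatrix_conjTranspose_mul_self {W : ℕ} (hW : 0 < W) :
    (fourierMatrix W)ᴴ * fourierMatrix W = 1 := by
  have hW0 : (W : ℂ) ≠ 0 := by exact_mod_cast hW.ne'
  ext α ω
  rw [Matrix.mul_apply]
  set z : ℂ := Complex.exp (2 * Real.pi * Complex.I * (((α : ℤ) - (ω : ℤ) : ℤ) : ℂ) / W) with hz
  have hterm : ∀ n : Fin W, (fourierMatrix W)ᴴ α n * fourierMatrix W n ω = 1 / W * z ^ (n : ℕ) := by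
    intro n
    have hsq : ((1 / Real.sqrt W : ℝ) : ℂ) * ((1 / Real.sqrt W : ℝ) : ℂ) = 1 / W := by
      rw [← Complex.ofReal_mul, div_mul_div_comm, Real.mul_self_sqrt (Nat.cast_nonneg W)]
      push_cast; ring
    rw [Matrix.conjTranspose_apply, fourierMatrix, Matrix.of_apply, Matrix.of_apply,
      RCLike.star_def, map_mul, Complex.conj_ofReal, ← Complex.exp_conj, ← hsq, hz,
      ← Complex.exp_nat_mul]
    rw [mul_mul_mul_comm, ← Complex.exp_add]
    congr 2
    simp only [map_div₀, map_neg, map_mul, Complex.conj_ofReal, Complex.conj_I, map_natCast,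
      map_intCast, map_ofNat]
    push_cast
    field_simp
    ring
  rw [Finset.sum_congr rfl fun n _ => hterm n, ← Finset.mul_sum,
    Fin.sum_univ_eq_sum_range fun n => z ^ n]
  by_cases h : α = ω
  · subst h
    simp [hz, hW0]
  · rw [Matrix.one_apply_ne h]
    have hz1 : z ≠ 1 := by
      intro h1
      obtain ⟨m, hm⟩ := Complex.exp_eq_one_iff.1 h1
      have h2 : (((α : ℤ) - (ω : ℤ) : ℤ) : ℂ) = ((m * W : ℤ) : ℂ) := by
        have hpi := Complex.two_pi_I_ne_zero
        rw [div_eq_iff hW0] at hm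
        have : 2 * (Real.pi : ℂ) * Complex.I * (((α : ℤ) - (ω : ℤ) : ℤ) : ℂ) =
            2 * (Real.pi : ℂ) * Complex.I * ((m * W : ℤ) : ℂ) := by rw [hm]; push_cast; ring
        exact mul_left_cancel₀ hpi this
      have h3 : (α : ℤ) - (ω : ℤ) = m * W := by exact_mod_cast h2
      have hα := Finset.mem_Ioc.1 α.2
      have hω := Finset.mem_Ioc.1 ω.2
      have hlt : |(α : ℤ) - ω| < W := by rw [abs_lt]; constructor <;> linarith
      have h0 := Int.eq_zero_of_abs_lt_dvd (Dvd.intro_left m h3.symm) hlt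
      exact h (Subtype.ext (by linarith))
    have hzW : z ^ W = 1 := by
      rw [hz, ← Complex.exp_nat_mul, Complex.exp_eq_one_iff]
      exact ⟨(α : ℤ) - ω, by push_cast; field_simp⟩
    rw [geom_sum_eq hz1, hzW, sub_self, zero_div, mul_zero]

lemma norm_fourierMatrix_le {W : ℕ} (hW : 0 < W) : ‖fourierMatrix W‖ ≤ 1 := by
  have h := Matrix.l2_opNorm_conjTranspose_mul_self (fourierMatrix W)
  rw [fourierMatrix_conjTranspose_mul_self hW] at h
  have h1 : ‖(1 : Matrix (Freq W) (Freq W) ℂ)‖ ≤ 1 := by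
    rw [← Matrix.diagonal_one, Matrix.l2_opNorm_diagonal]
    exact (pi_norm_le_iff_of_nonneg zero_le_one).2 fun _ => by simp
  rw [h] at h1
  nlinarith [norm_nonneg (fourierMatrix W)]

/-- The real sign vector of a family of integer units. -/
def signVector {n : Type*} (s : n → ℤˣ) : n → ℝ := fun j => ((s j : ℤ) : ℝ)

variable {R B : ℕ}

lemma samplerMatrix_apply_finProdFinEquiv (hR : 0 < R) (r r' : Fin R) (b : Fin B) :
    samplerMatrix R (R * B) r' (finProdFinEquiv (r, b)) = if r = r' then 1 else 0 := by
  rw [samplerMatrix, Matrix.of_apply, Nat.mul_div_cancel_left B hR, finProdFinEquiv_apply_val]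
  refine if_congr ?_ rfl rfl
  have hb := b.2
  constructor
  · rintro ⟨h1, h2⟩
    have h1' : (r' : ℕ) < r + 1 := by
      by_contra hc
      have : ((r : ℕ) + 1) * B ≤ r' * B := Nat.mul_le_mul_right B (not_lt.1 hc)
      nlinarith
    have h2' : (r : ℕ) < r' + 1 := by
      by_contra hc
      have : ((r' : ℕ) + 1) * B ≤ r * B := Nat.mul_le_mul_right B (not_lt.1 hc)
      nlinarith
    exact Fin.ext (by omega)
  · rintro rfl
    constructor <;> simp only <;> nlinarith

/-- The rows of the sampler are orthogonal with squared norm `B`. -/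
lemma norm_samplerMatrix_sq_le (hR : 0 < R) : ‖samplerMatrix R (R * B)‖ ^ 2 ≤ B := by
  have h : samplerMatrix R (R * B) * (samplerMatrix R (R * B))ᴴ =
      Matrix.diagonal fun _ => (B : ℂ) := by
    ext r r'
    rw [Matrix.mul_apply, ← finProdFinEquiv.sum_comp, Fintype.sum_prod_type]
    simp only [Matrix.conjTranspose_apply, samplerMatrix_apply_finProdFinEquiv hR]
    rw [Matrix.diagonal_apply]
    by_cases hr : r = r'
    · subst hr; simp
    · simp only [hr, if_false]
      refine Finset.sum_eq_zero fun x _ => Finset.sum_eq_zero fun b _ => ?_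
      by_cases hx : x = r
      · simp [hx, hr]
      · simp [hx]
  have h2 := Matrix.l2_opNorm_conjTranspose_mul_self (samplerMatrix R (R * B))ᴴ
  rw [Matrix.conjTranspose_conjTranspose, Matrix.l2_opNorm_conjTranspose, h,
    Matrix.l2_opNorm_diagonal] at h2
  rw [sq, ← h2]
  exact (pi_norm_le_iff_of_nonneg (Nat.cast_nonneg B)).2 fun _ => by simp

lemma norm_demodulatorMatrix_sq_le (hR : 0 < R) (hB : 0 < B) (s : Fin (R * B) → ℤˣ) :
    ‖demodulatorMatrix R (signVector s)‖ ^ 2 ≤ B := by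
  have hD : ‖chippingMatrix (signVector s)‖ ≤ 1 := by
    rw [chippingMatrix, Matrix.l2_opNorm_diagonal]
    refine (pi_norm_le_iff_of_nonneg zero_le_one).2 fun j => ?_
    rcases Int.units_eq_one_or (s j) with h | h <;> simp [signVector, h]
  have h : ‖demodulatorMatrix R (signVector s)‖ ≤ ‖samplerMatrix R (R * B)‖ := by
    refine (Matrix.l2_opNorm_mul _ _).trans ?_
    refine (mul_le_of_le_one_right (norm_nonneg _)
      (norm_fourierMatrix_le (Nat.mul_pos hR hB))).trans ?_
    exact (Matrix.l2_opNorm_mul _ _).trans (mul_le_of_le_one_right (norm_nonneg _) hD)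
  exact (pow_le_pow_left₀ (norm_nonneg _) h 2).trans (norm_samplerMatrix_sq_le hR)

/-- The Gram matrix of the columns of the demodulator. -/
noncomputable def demodulatorGram (R : ℕ) {W : ℕ} (ε : Fin W → ℝ) : Matrix (Freq W) (Freq W) ℂ :=
  (demodulatorMatrix R ε)ᴴ * demodulatorMatrix R ε

lemma isHermitian_demodulatorGram {W : ℕ} (ε : Fin W → ℝ) : (demodulatorGram R ε).IsHermitian :=
  Matrix.isHermitian_conjTranspose_mul_self _

lemma norm_demodulatorGram_le (hR : 0 < R) (hB : 0 < B) (s : Fin (R * B) → ℤˣ) :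
    ‖demodulatorGram R (signVector s)‖ ≤ B := by
  rw [demodulatorGram, Matrix.l2_opNorm_conjTranspose_mul_self, ← sq]
  exact norm_demodulatorMatrix_sq_le hR hB s

/-- Column `ω` of `Φᴴ Φ` is the image under `Φᴴ` of column `ω` of `Φ`, whose squared norm is the
diagonal entry. -/
lemma sum_norm_sq_demodulatorGram_le (hR : 0 < R) (hB : 0 < B) (s : Fin (R * B) → ℤˣ)
    (ω : Freq (R * B)) :
    ∑ α, ‖demodulatorGram R (signVector s) α ω‖ ^ 2 ≤
      B * ‖demodulatorGram R (signVector s) ω ω‖ := by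
  set Φ := demodulatorMatrix R (signVector s) with hΦ
  have h := sum_norm_sq_mulVec_le Φᴴ (fun r => Φ r ω)
  rw [Matrix.l2_opNorm_conjTranspose] at h
  refine (h.trans (mul_le_mul_of_nonneg_right (norm_demodulatorMatrix_sq_le hR hB s)
    (Finset.sum_nonneg fun _ _ => by positivity))).trans ?_
  refine mul_le_mul_of_nonneg_left ?_ (Nat.cast_nonneg B)
  have h2 : demodulatorGram R (signVector s) ω ω = star (fun r => Φ r ω) ⬝ᵥ fun r => Φ r ω := rfl
  rw [h2, ← re_star_dotProduct_self]
  exact Complex.re_le_norm _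

/-- Splitting the `R * B` time indices into `R` blocks of length `B`, row `r` of the demodulator
only sees the signs of block `r`. -/
lemma demodulatorMatrix_apply (hR : 0 < R) (s : Fin (R * B) → ℤˣ) (r : Fin R)
    (ω : Freq (R * B)) :
    demodulatorMatrix R (signVector s) r ω =
      rademacherSum (fun b : Fin B => fourierMatrix (R * B) (finProdFinEquiv (r, b)) ω)
        (fun b => s (finProdFinEquiv (r, b))) := by
  rw [demodulatorMatrix, Matrix.mul_apply, ← finProdFinEquiv.sum_comp, Fintype.sum_prod_type]
  simp only [chippingMatrix, Matrix.mul_diagonal, samplerMatrix_apply_finProdFinEquiv hR]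
  rw [Finset.sum_eq_single r (fun r' _ hr' => by simp [hr']) (by simp)]
  simp only [if_true, one_mul, rademacherSum, signVector]
  refine Finset.sum_congr rfl fun b _ => ?_
  push_cast
  ring

/-- The deviation of the Gram matrix from the identity is a sum over the `R` blocks of centred
products of Rademacher sums. -/
lemma demodulatorGram_sub_one_apply (hR : 0 < R) (hB : 0 < B) (s : Fin (R * B) → ℤˣ)
    (α ω : Freq (R * B)) :
    (demodulatorGram R (signVector s) - 1) α ω =
      ∑ r, (star (rademacherSum (fun b : Fin B => fourierMatrix (R * B) (finProdFinEquiv (r, b)) α)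
          (fun b => s (finProdFinEquiv (r, b)))) *
        rademacherSum (fun b : Fin B => fourierMatrix (R * B) (finProdFinEquiv (r, b)) ω)
          (fun b => s (finProdFinEquiv (r, b))) -
        ∑ b, star (fourierMatrix (R * B) (finProdFinEquiv (r, b)) α) *
          fourierMatrix (R * B) (finProdFinEquiv (r, b)) ω) := by
  rw [Matrix.sub_apply, ← fourierMatrix_conjTranspose_mul_self (Nat.mul_pos hR hB),
    Matrix.mul_apply, ← finProdFinEquiv.sum_comp, Fintype.sum_prod_type, demodulatorGram,
    Matrix.mul_apply, ← Finset.sum_sub_distrib]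
  simp only [Matrix.conjTranspose_apply, demodulatorMatrix_apply hR]

lemma exists_phase_half_norm_le_re (z : ℂ) :
    ∃ ζ ∈ ({1, -1, Complex.I, -Complex.I} : Finset ℂ), ‖z‖ / 2 ≤ (ζ * z).re := by
  have h := Complex.norm_le_abs_re_add_abs_im z
  rcases le_total (‖z‖ / 2) |z.re| with h1 | h1
  · rcases abs_choice z.re with h2 | h2
    · exact ⟨1, by simp, by rw [one_mul, ← h2]; exact h1⟩
    · exact ⟨-1, by simp, by rw [neg_one_mul, Complex.neg_re, ← h2]; exact h1⟩
  · have h1' : ‖z‖ / 2 ≤ |z.im| := by linarith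
    rcases abs_choice z.im with h2 | h2
    · exact ⟨-Complex.I, by simp, by simp; linarith⟩
    · exact ⟨Complex.I, by simp, by simp; linarith⟩

/-- Coherence: all entries of the Gram matrix are close to those of the identity, except for a
small fraction of the chipping sequences. -/
theorem card_exists_le_norm_demodulatorGram_sub_one_le (hR : 0 < R) (hB : 0 < B) {μ : ℝ}
    (hμ0 : 0 ≤ μ) (hμ1 : μ ≤ 1) :
    ((Finset.univ.filter fun s : Fin (R * B) → ℤˣ =>
      ∃ α ω, μ ≤ ‖(demodulatorGram R (signVector s) - 1) α ω‖).card : ℝ) ≤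
      2 ^ (R * B) * (4 * ((R * B : ℕ) : ℝ) ^ 2 * Real.exp (-(R * μ ^ 2 / 24576))) := by
  classical
  have hsub : (Finset.univ.filter fun s : Fin (R * B) → ℤˣ =>
      ∃ α ω, μ ≤ ‖(demodulatorGram R (signVector s) - 1) α ω‖) ⊆
      (Finset.univ : Finset (Freq (R * B) × Freq (R * B))).biUnion fun x =>
        ({1, -1, Complex.I, -Complex.I} : Finset ℂ).biUnion fun ζ =>
          Finset.univ.filter fun s : Fin (R * B) → ℤˣ =>
            μ / 2 ≤ (ζ * (demodulatorGram R (signVector s) - 1) x.1 x.2).re := by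
    intro s hs
    obtain ⟨α, ω, h⟩ := (Finset.mem_filter.1 hs).2
    obtain ⟨ζ, hζ, h'⟩ := exists_phase_half_norm_le_re ((demodulatorGram R (signVector s) - 1) α ω)
    exact Finset.mem_biUnion.2 ⟨(α, ω), Finset.mem_univ _, Finset.mem_biUnion.2 ⟨ζ, hζ,
      Finset.mem_filter.2 ⟨Finset.mem_univ _, by linarith⟩⟩⟩
  have hRpos : (0 : ℝ) < R := by exact_mod_cast hR
  have hBpos : (0 : ℝ) < B := by exact_mod_cast hB
  have hone : ∀ (α ω : Freq (R * B)) (ζ : ℂ), ζ ∈ ({1, -1, Complex.I, -Complex.I} : Finset ℂ) →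
      ((Finset.univ.filter fun s : Fin (R * B) → ℤˣ =>
        μ / 2 ≤ (ζ * (demodulatorGram R (signVector s) - 1) α ω).re).card : ℝ) ≤
      2 ^ (R * B) * Real.exp (-(R * μ ^ 2 / 24576)) := by
    intro α ω ζ hζ
    have hζ1 : ‖ζ‖ ≤ 1 := by
      simp only [Finset.mem_insert, Finset.mem_singleton] at hζ
      rcases hζ with rfl | rfl | rfl | rfl <;> simp
    have hnorm : ∀ (ω : Freq (R * B)) (r : Fin R), (R : ℝ) * ∑ b : Fin B,
        ‖fourierMatrix (R * B) (finProdFinEquiv (r, b)) ω‖ ^ 2 ≤ 1 := by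
      intro ω r
      simp only [norm_fourierMatrix_apply, Finset.sum_const, Finset.card_univ, Fintype.card_fin,
        nsmul_eq_mul]
      push_cast
      refine le_of_eq ?_
      field_simp
    have h := card_le_re_sum_block_le
      (fun (r : Fin R) (b : Fin B) => fourierMatrix (R * B) (finProdFinEquiv (r, b)) α)
      (fun (r : Fin R) (b : Fin B) => fourierMatrix (R * B) (finProdFinEquiv (r, b)) ω)
      (hnorm α) (hnorm ω) hζ1 (t := μ / 2) (by linarith) (by linarith)
    rw [show (R : ℝ) * (μ / 2) ^ 2 / 6144 = R * μ ^ 2 / 24576 by ring] at h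
    refine le_trans ?_ h
    have hle := Finset.card_le_card_of_injOn
      (s := Finset.univ.filter fun s : Fin (R * B) → ℤˣ =>
        μ / 2 ≤ (ζ * (demodulatorGram R (signVector s) - 1) α ω).re)
      (t := Finset.univ.filter fun e : Fin R → Fin B → ℤˣ => μ / 2 ≤
        (ζ * ∑ r, (star (rademacherSum
            (fun b : Fin B => fourierMatrix (R * B) (finProdFinEquiv (r, b)) α) (e r)) *
          rademacherSum (fun b : Fin B => fourierMatrix (R * B) (finProdFinEquiv (r, b)) ω) (e r) -
          ∑ b, star (fourierMatrix (R * B) (finProdFinEquiv (r, b)) α) *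
            fourierMatrix (R * B) (finProdFinEquiv (r, b)) ω)).re)
      (fun s r b => s (finProdFinEquiv (r, b)))
      (fun s hs => by
        simp only [Finset.coe_filter, Finset.mem_univ, true_and, Set.mem_ofPred_eq] at hs ⊢
        rw [demodulatorGram_sub_one_apply hR hB] at hs
        exact hs)
      (fun s _ s' _ hss => by
        funext j
        obtain ⟨⟨r, b⟩, rfl⟩ := finProdFinEquiv.surjective j
        exact congrFun (congrFun hss r) b)
    exact_mod_cast hle
  calc _ ≤ ((∑ x : Freq (R * B) × Freq (R * B), ∑ ζ ∈ ({1, -1, Complex.I, -Complex.I} : Finset ℂ),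
        (Finset.univ.filter fun s : Fin (R * B) → ℤˣ =>
            μ / 2 ≤ (ζ * (demodulatorGram R (signVector s) - 1) x.1 x.2).re).card : ℕ) : ℝ) := by
        refine Nat.cast_le.2 ((Finset.card_le_card hsub).trans (Finset.card_biUnion_le.trans ?_))
        exact Finset.sum_le_sum fun x _ => Finset.card_biUnion_le
    _ ≤ ∑ x : Freq (R * B) × Freq (R * B), ∑ ζ ∈ ({1, -1, Complex.I, -Complex.I} : Finset ℂ),
        (2 ^ (R * B) * Real.exp (-(R * μ ^ 2 / 24576))) := by
        push_cast
        exact Finset.sum_le_sum fun x _ => Finset.sum_le_sum fun ζ hζ => hone x.1 x.2 ζ hζ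
    _ ≤ ∑ x : Freq (R * B) × Freq (R * B),
        4 * (2 ^ (R * B) * Real.exp (-(R * μ ^ 2 / 24576))) := by
        refine Finset.sum_le_sum fun x _ => ?_
        rw [Finset.sum_const, nsmul_eq_mul]
        gcongr
        exact_mod_cast Finset.card_le_four
    _ = _ := by
        rw [Finset.sum_const, Finset.card_univ, Fintype.card_prod, card_freq, nsmul_eq_mul]
        push_cast
        ring

end Demodulator

/-! ### Counting ill-conditioned configurations -/

section Counting

variable {ι : Type*} [Fintype ι] [DecidableEq ι]

lemma norm_submatrix_val_le (S : Finset ι) (A : Matrix ι ι ℂ) :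
    ‖A.submatrix (Subtype.val : {i // i ∈ S} → ι)
      (Subtype.val : {i // i ∈ S} → ι)‖ ≤ ‖A‖ := by
  set E : Matrix ι {i // i ∈ S} ℂ := (1 : Matrix ι ι ℂ).submatrix id Subtype.val with hE
  have hEE : Eᴴ * E = 1 := by
    ext i j
    by_cases h : i = j
    · subst h
      simp [hE, Matrix.mul_apply, Matrix.one_apply]
    · have h' : i.1 ≠ j.1 := fun h' => h (Subtype.ext h')
      simp [hE, Matrix.mul_apply, Matrix.one_apply, h, h']
  have hE1 : ‖E‖ ≤ 1 := by
    have h := Matrix.l2_opNorm_conjTranspose_mul_self E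
    have h1 : ‖(1 : Matrix {i // i ∈ S} {i // i ∈ S} ℂ)‖ ≤ 1 := by
      rw [← Matrix.diagonal_one, Matrix.l2_opNorm_diagonal]
      exact (pi_norm_le_iff_of_nonneg zero_le_one).2 fun _ => by simp
    rw [hEE] at h
    nlinarith [norm_nonneg E]
  have hA : A.submatrix (Subtype.val : {i // i ∈ S} → ι)
      (Subtype.val : {i // i ∈ S} → ι) = Eᴴ * A * E := by
    ext i j
    simp [hE, Matrix.mul_apply, Matrix.one_apply]
  rw [hA]
  calc _ ≤ ‖Eᴴ * A‖ * ‖E‖ := Matrix.l2_opNorm_mul _ _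
    _ ≤ ‖Eᴴ‖ * ‖A‖ * ‖E‖ := by gcongr; exact Matrix.l2_opNorm_mul _ _
    _ ≤ 1 * ‖A‖ * 1 := by
        rw [Matrix.l2_opNorm_conjTranspose]
        gcongr
    _ = ‖A‖ := by ring

/-- The Gram matrix of the columns in `S`, minus the identity, splits into its off-diagonal part and
a diagonal matrix with small entries. -/
lemma norm_columnSubmatrix_gram_sub_one_le {m : Type*} [Fintype m] (Φ : Matrix m ι ℂ)
    (S : Finset ι) {μ : ℝ} (hμ0 : 0 ≤ μ) (hμ : ∀ i, ‖(Φᴴ * Φ - 1 : Matrix ι ι ℂ) i i‖ ≤ μ) :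
    ‖(columnSubmatrix Φ S)ᴴ * columnSubmatrix Φ S - 1‖ ≤ ‖offDiagPart S (Φᴴ * Φ)‖ + μ := by
  have h : (columnSubmatrix Φ S)ᴴ * columnSubmatrix Φ S - 1 =
      (offDiagPart S (Φᴴ * Φ)).submatrix (Subtype.val : {i // i ∈ S} → ι)
      (Subtype.val : {i // i ∈ S} → ι) +
        Matrix.diagonal fun i => (Φᴴ * Φ - 1 : Matrix ι ι ℂ) i.1 i.1 := by
    ext i j
    have hG : ((columnSubmatrix Φ S)ᴴ * columnSubmatrix Φ S) i j = (Φᴴ * Φ) i.1 j.1 := rfl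
    rw [Matrix.sub_apply, Matrix.add_apply, hG, Matrix.submatrix_apply, offDiagPart,
      Matrix.of_apply]
    by_cases hij : i = j
    · subst hij; simp
    · have hij' : i.1 ≠ j.1 := fun h => hij (Subtype.ext h)
      simp [hij, hij', Matrix.one_apply_ne]
  rw [h]
  refine (norm_add_le _ _).trans (add_le_add (norm_submatrix_val_le S _) ?_)
  rw [Matrix.l2_opNorm_diagonal]
  exact (pi_norm_le_iff_of_nonneg hμ0).2 fun i => hμ i.1

end Counting

section Conditioning

variable {W R B : ℕ}

/-- For a chipping sequence whose Gram matrix is entrywise close to the identity, few sets of `K`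
columns are ill conditioned.
The constants make the `2 p`-th moment of the off-diagonal part at most
`2 W ^ 2 (81 * 16) ^ (-p)` with `W ≤ exp p`. -/
lemma card_ill_conditioned_le (hR : 0 < R) (hB : 0 < B) (hW : W = R * B) (hW2 : 2 ≤ W)
    {p K : ℕ} (hp : p ≠ 0)
    (hWp : (W : ℝ) ≤ Real.exp p)
    (hRK : (512 * 81 * 122880 : ℝ) * (K * p + p ^ 3) ≤ R) {μ : ℝ} (hμ0 : 0 ≤ μ)
    (hμ : R * μ ^ 2 = 122880 * p) (s : Fin W → ℤˣ)
    (hs : ∀ α ω, ‖(demodulatorGram R (signVector s) - 1) α ω‖ ≤ μ) :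
    ((((Finset.univ : Finset (Freq W)).powersetCard K).filter fun S => (0.5 : ℝ) ≤
      ‖(columnSubmatrix (demodulatorMatrix R (signVector s)) S)ᴴ *
        columnSubmatrix (demodulatorMatrix R (signVector s)) S - 1‖).card : ℝ) ≤
      W.choose K * (W : ℝ)⁻¹ := by
  have hcolsum : ∀ ω, ∑ α, ‖demodulatorGram R (signVector s) α ω‖ ^ 2 ≤
      B * ‖demodulatorGram R (signVector s) ω ω‖ := by
    subst hW; exact sum_norm_sq_demodulatorGram_le hR hB s
  have hnorm : ‖demodulatorGram R (signVector s)‖ ≤ B := by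
    subst hW; exact norm_demodulatorGram_le hR hB s
  have hRpos : (0 : ℝ) < R := by exact_mod_cast hR
  have hBpos : (0 : ℝ) < B := by exact_mod_cast hB
  have hB1 : (1 : ℝ) ≤ B := by exact_mod_cast hB
  have hp1 : (1 : ℝ) ≤ p := by exact_mod_cast Nat.one_le_iff_ne_zero.2 hp
  have hK0 : (0 : ℝ) ≤ K := Nat.cast_nonneg K
  have hKp : (K : ℝ) ≤ K * p := le_mul_of_one_le_right hK0 hp1
  have hp3 : (p : ℝ) ≤ p ^ 3 := le_self_pow₀ hp1 (by norm_num)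
  have hK2R : 2 * (K : ℝ) ≤ R := by nlinarith
  have hWcast : (W : ℝ) = R * B := by rw [hW]; push_cast; ring
  have hWpos : (0 : ℝ) < W := by rw [hWcast]; positivity
  have hRW : (R : ℝ) ≤ W := by rw [hWcast]; exact le_mul_of_one_le_right hRpos.le hB1
  have hKW : K ≤ W := by
    have : (K : ℝ) ≤ W := by linarith
    exact_mod_cast this
  have hμ4 : μ ≤ 1 / 4 := by
    have h1 : (512 * 81 : ℝ) * (R * μ ^ 2) ≤ R := by rw [hμ]; nlinarith
    have h2 : (512 * 81 : ℝ) * μ ^ 2 ≤ 1 := by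
      refine le_of_mul_le_mul_left ?_ hRpos
      linarith
    nlinarith
  set G := demodulatorGram R (signVector s) with hG
  have : Nonempty (Freq W) := by
    rw [← Fintype.card_pos_iff, card_freq]; omega
  have hdiag : ∀ ω, ‖G ω ω‖ ≤ 2 := fun ω => by
    have h1 := hs ω ω
    have h2 := norm_le_norm_sub_add (G ω ω) 1
    rw [Matrix.sub_apply, Matrix.one_apply_eq] at h1
    rw [norm_one] at h2
    linarith
  -- The rate `2 K / W` instead of `K / W` allows for sampling without replacement, where at least
  -- `W / 2` indices remain at every stage.
  have hmom := sum_norm_offDiagPart_pow_le (G := G) (β := B) (γ := B * 2) (μ := μ)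
    (δ := 2 * K / W) (isHermitian_demodulatorGram _)
    (fun ω => (hcolsum ω).trans (by gcongr; exact hdiag ω))
    (fun α ω h => by
      have h1 := hs α ω
      rwa [Matrix.sub_apply, Matrix.one_apply_ne h, sub_zero] at h1)
    hnorm (by positivity) hp (K := K) (by rw [card_freq]; exact hKW)
    (by
      rw [card_freq, div_mul_eq_mul_div, le_div_iff₀ hWpos]
      nlinarith)
  rw [card_freq] at hmom
  have hX : (p : ℝ) * (p * μ ^ 2 + 2 * K / W * (B * 2)) ≤ 1 / (512 * 81) := by
    have : (p : ℝ) * (p * μ ^ 2 + 2 * K / W * (B * 2)) =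
        (122880 * p ^ 3 + 4 * (K * p)) / R := by
      rw [eq_div_iff hRpos.ne']
      have e1 : 2 * (K : ℝ) / W * (B * 2) * R = 4 * K := by
        rw [hWcast]; field_simp; ring
      calc _ = (p : ℝ) * (p * (R * μ ^ 2) + 2 * (K : ℝ) / W * (B * 2) * R) := by ring
        _ = _ := by rw [e1, hμ]; ring
    rw [this, div_le_div_iff₀ hRpos (by norm_num)]
    nlinarith
  have hY : 2 * (K : ℝ) / W * (p * (B * 2) + 2 * K / W * (B : ℝ) ^ 2) ≤ 1 / (512 * 81) := by
    have h1 : 2 * (K : ℝ) / W * (p * (B * 2) + 2 * K / W * (B : ℝ) ^ 2) =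
        (4 * (K * p) + 4 * K * (K / R)) / R := by
      rw [hWcast]; field_simp; ring
    have h2 : (K : ℝ) / R ≤ p := by
      rw [div_le_iff₀ hRpos]
      nlinarith
    rw [h1, div_le_div_iff₀ hRpos (by norm_num)]
    have h3 : 4 * (K : ℝ) * (K / R) ≤ 4 * (K * p) := by
      have := mul_le_mul_of_nonneg_left h2 hK0
      linarith
    nlinarith
  have hmom2 : ∑ S ∈ (Finset.univ : Finset (Freq W)).powersetCard K,
      ‖offDiagPart S G‖ ^ (2 * p) ≤
      W.choose K * (32 ^ p * (W : ℝ) ^ 2 * (2 * (1 / (512 * 81)) ^ p)) := by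
    refine hmom.trans ?_
    rw [two_mul (((1 : ℝ) / (512 * 81)) ^ p)]
    gcongr
  have hmarkov : ((((Finset.univ : Finset (Freq W)).powersetCard K).filter fun S => (0.5 : ℝ) ≤
      ‖(columnSubmatrix (demodulatorMatrix R (signVector s)) S)ᴴ *
        columnSubmatrix (demodulatorMatrix R (signVector s)) S - 1‖).card : ℝ) *
        (1 / 4) ^ (2 * p) ≤ ∑ S ∈ (Finset.univ : Finset (Freq W)).powersetCard K,
      ‖offDiagPart S G‖ ^ (2 * p) := by
    rw [← nsmul_eq_mul]
    refine (Finset.card_nsmul_le_sum _ (fun S => ‖offDiagPart S G‖ ^ (2 * p)) _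
      fun S hS => ?_).trans (Finset.sum_le_sum_of_subset_of_nonneg (Finset.filter_subset _ _)
        fun _ _ _ => by positivity)
    have h1 := (Finset.mem_filter.1 hS).2
    have h2 := norm_columnSubmatrix_gram_sub_one_le (demodulatorMatrix R (signVector s)) S hμ0
      fun i => hs i i
    refine pow_le_pow_left₀ (by norm_num) ?_ _
    have h3 := h1.trans h2
    norm_num at h3
    change 1 / 4 ≤ ‖offDiagPart S ((demodulatorMatrix R (signVector s))ᴴ *
      demodulatorMatrix R (signVector s))‖
    linarith
  have hpos : (0 : ℝ) < (1 / 4) ^ (2 * p) := by positivity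
  refine le_of_mul_le_mul_right (hmarkov.trans (hmom2.trans ?_)) hpos
  have h81 : (1 / 81 : ℝ) ^ p ≤ ((W : ℝ) ^ 4)⁻¹ := by
    have he : Real.exp 4 ≤ 81 := by
      have h1 : Real.exp 4 = Real.exp 1 ^ 4 := by rw [← Real.exp_nat_mul]; norm_num
      have h2 : Real.exp 1 ≤ 3 := by have := Real.exp_one_lt_d9; linarith
      rw [h1]
      calc _ ≤ (3 : ℝ) ^ 4 := pow_le_pow_left₀ (Real.exp_pos _).le h2 4
        _ = 81 := by norm_num
    rw [one_div, inv_pow]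
    refine inv_anti₀ (by positivity) ?_
    calc (W : ℝ) ^ 4 ≤ Real.exp p ^ 4 := pow_le_pow_left₀ hWpos.le hWp 4
      _ = Real.exp 4 ^ p := by rw [← Real.exp_nat_mul, ← Real.exp_nat_mul]; congr 1; push_cast; ring
      _ ≤ _ := pow_le_pow_left₀ (Real.exp_pos _).le he p
  have hpw : (32 : ℝ) ^ p * (1 / (512 * 81)) ^ p = (1 / 81) ^ p * (1 / 4) ^ (2 * p) := by
    rw [pow_mul, ← mul_pow, ← mul_pow]; norm_num
  have hW2' : (2 : ℝ) ≤ W := by exact_mod_cast hW2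
  calc _ = (W.choose K : ℝ) * (2 * (W : ℝ) ^ 2 * (32 ^ p * (1 / (512 * 81)) ^ p)) := by ring
    _ = (W.choose K : ℝ) * (2 * (W : ℝ) ^ 2 * (1 / 81) ^ p) * (1 / 4) ^ (2 * p) := by
        rw [hpw]; ring
    _ ≤ (W.choose K : ℝ) * (2 * (W : ℝ) ^ 2 * ((W : ℝ) ^ 4)⁻¹) * (1 / 4) ^ (2 * p) := by gcongr
    _ ≤ _ := by
        gcongr
        have : 2 * (W : ℝ) ^ 2 * ((W : ℝ) ^ 4)⁻¹ = 2 / W * (W : ℝ)⁻¹ := by field_simp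
        rw [this]
        refine mul_le_of_le_one_left (by positivity) ?_
        rw [div_le_one hWpos]
        exact hW2'

/-- Among all pairs of a chipping sequence and a `K`-set, at most a fraction `2 / W` is ill
conditioned. -/
theorem sum_card_ill_conditioned_le (hR : 0 < R) (hB : 0 < B) (hW : W = R * B) (hW2 : 2 ≤ W)
    {p K : ℕ}
    (hp : p ≠ 0) (hWp : (W : ℝ) ≤ Real.exp p)
    (hRK : (512 * 81 * 122880 : ℝ) * (K * p + p ^ 3) ≤ R) :
    ∑ s : Fin W → ℤˣ,
      ((((Finset.univ : Finset (Freq W)).powersetCard K).filter fun S => (0.5 : ℝ) ≤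
        ‖(columnSubmatrix (demodulatorMatrix R (signVector s)) S)ᴴ *
          columnSubmatrix (demodulatorMatrix R (signVector s)) S - 1‖).card : ℝ) ≤
      2 ^ W * W.choose K * (2 * (W : ℝ)⁻¹) := by
  have hRpos : (0 : ℝ) < R := by exact_mod_cast hR
  have hp1 : (1 : ℝ) ≤ p := by exact_mod_cast Nat.one_le_iff_ne_zero.2 hp
  have hp3 : (p : ℝ) ≤ p ^ 3 := le_self_pow₀ hp1 (by norm_num)
  -- Here `122880 = 5 * 24576`, so that the coherence bound yields `exp (-5 p) ≤ W ^ (-5)`.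
  set μ : ℝ := Real.sqrt (122880 * p / R) with hμdef
  have hμ0 : 0 ≤ μ := Real.sqrt_nonneg _
  have hμ : R * μ ^ 2 = 122880 * p := by
    rw [hμdef, Real.sq_sqrt (by positivity)]; field_simp
  have hμ1 : μ ≤ 1 := by
    rw [hμdef, Real.sqrt_le_iff, one_pow, div_le_one hRpos]
    refine ⟨zero_le_one, ?_⟩
    have : 0 ≤ (K : ℝ) * p := by positivity
    nlinarith
  have hcoh : ((Finset.univ.filter fun s : Fin W → ℤˣ =>
      ∃ α ω, μ ≤ ‖(demodulatorGram R (signVector s) - 1) α ω‖).card : ℝ) ≤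
      2 ^ W * (4 * (W : ℝ) ^ 2 * Real.exp (-(R * μ ^ 2 / 24576))) := by
    subst hW; exact card_exists_le_norm_demodulatorGram_sub_one_le hR hB hμ0 hμ1
  have hWpos : (0 : ℝ) < W := by exact_mod_cast (by omega : 0 < W)
  have hW2' : (2 : ℝ) ≤ W := by exact_mod_cast hW2
  have hexp : 4 * (W : ℝ) ^ 2 * Real.exp (-(R * μ ^ 2 / 24576)) ≤ (W : ℝ)⁻¹ := by
    rw [hμ, show (122880 : ℝ) * p / 24576 = ((5 : ℕ) : ℝ) * p by push_cast; ring, Real.exp_neg,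
      Real.exp_nat_mul]
    calc 4 * (W : ℝ) ^ 2 * (Real.exp p ^ 5)⁻¹ ≤ 4 * (W : ℝ) ^ 2 * ((W : ℝ) ^ 5)⁻¹ := by gcongr
      _ = 4 / (W : ℝ) ^ 2 * (W : ℝ)⁻¹ := by field_simp
      _ ≤ _ := by
        refine mul_le_of_le_one_left (by positivity) ?_
        rw [div_le_one (by positivity)]
        nlinarith
  have hpt : ∀ s : Fin W → ℤˣ,
      ((((Finset.univ : Finset (Freq W)).powersetCard K).filter fun S => (0.5 : ℝ) ≤
        ‖(columnSubmatrix (demodulatorMatrix R (signVector s)) S)ᴴ *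
          columnSubmatrix (demodulatorMatrix R (signVector s)) S - 1‖).card : ℝ) ≤
      (if ∃ α ω, μ ≤ ‖(demodulatorGram R (signVector s) - 1) α ω‖ then (W.choose K : ℝ) else 0) +
        W.choose K * (W : ℝ)⁻¹ := by
    intro s
    split_ifs with h
    · refine le_add_of_le_of_nonneg ?_ (by positivity)
      refine Nat.cast_le.2 ((Finset.card_filter_le _ _).trans (le_of_eq ?_))
      rw [Finset.card_powersetCard, Finset.card_univ, card_freq]
    · rw [zero_add]
      refine card_ill_conditioned_le hR hB hW hW2 hp hWp hRK hμ0 hμ s fun α ω => ?_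
      by_contra hc
      exact h ⟨α, ω, (not_le.1 hc).le⟩
  refine (Finset.sum_le_sum fun s _ => hpt s).trans ?_
  rw [Finset.sum_add_distrib, ← Finset.sum_filter, Finset.sum_const, Finset.sum_const,
    Finset.card_univ, nsmul_eq_mul, nsmul_eq_mul]
  have hcard : (Fintype.card (Fin W → ℤˣ) : ℝ) = 2 ^ W := by simp
  rw [hcard]
  have h1 : ((Finset.univ.filter fun s : Fin W → ℤˣ =>
      ∃ α ω, μ ≤ ‖(demodulatorGram R (signVector s) - 1) α ω‖).card : ℝ) * W.choose K ≤
      2 ^ W * (W : ℝ)⁻¹ * W.choose K := by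
    refine mul_le_mul_of_nonneg_right (hcoh.trans ?_) (Nat.cast_nonneg _)
    gcongr
  linarith

end Conditioning

/-! ### Passage from counting to probability -/

section Transfer

variable {𝒳 : Type*} [MeasurableSpace 𝒳] {P : Measure 𝒳}

lemma ae_mem_of_hasLaw_uniformOn {α : Type*} [MeasurableSpace α] [MeasurableSingletonClass α]
    {X : 𝒳 → α} {t : Finset α} (h : HasLaw X (uniformOn (t : Set α)) P) : ∀ᵐ x ∂P, X x ∈ t := by
  have h1 : P.map X (t : Set α)ᶜ = 0 := by
    rw [h.map_eq, uniformOn, cond_apply t.measurableSet]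
    simp
  rw [Measure.map_apply_of_aemeasurable h.aemeasurable t.measurableSet.compl] at h1
  rw [ae_iff]
  exact h1

lemma measure_preimage_singleton_of_hasLaw_uniformOn {α : Type*} [MeasurableSpace α]
    [MeasurableSingletonClass α] {X : 𝒳 → α} {t : Finset α}
    (h : HasLaw X (uniformOn (t : Set α)) P) {a : α} (ha : a ∈ t) :
    P (X ⁻¹' {a}) = (t.card : ENNReal)⁻¹ := by
  classical
  rw [← Measure.map_apply_of_aemeasurable h.aemeasurable (measurableSet_singleton a), h.map_eq,
    ← Finset.coe_singleton, uniformOn_apply_finset, Finset.inter_singleton_of_mem ha]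
  simp

lemma rademacherLaw_eq : rademacherLaw = uniformOn ((({1, -1} : Finset ℝ) : Set ℝ)) := by
  simp [rademacherLaw]

lemma uniformSubsetLaw_eq (W K : ℕ) : uniformSubsetLaw W K =
    uniformOn (((Finset.univ : Finset (Freq W)).powersetCard K : Set (Finset (Freq W)))) := by
  rw [uniformSubsetLaw]
  congr 1
  ext S
  simp only [Set.mem_ofPred_eq, Finset.mem_coe, Finset.mem_powersetCard, Finset.subset_univ,
    true_and]

variable {W K : ℕ} {ε : Fin W → 𝒳 → ℝ} {S : 𝒳 → Finset (Freq W)}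

lemma measure_signs_inter_set_eq [IsProbabilityMeasure P] (hε : ∀ j, HasLaw (ε j) rademacherLaw P)
    (hind : iIndepFun ε P) (hS : HasLaw S (uniformSubsetLaw W K) P)
    (hεS : IndepFun (fun x j => ε j x) S P) (s : Fin W → ℤˣ) {T : Finset (Freq W)}
    (hT : T ∈ (Finset.univ : Finset (Freq W)).powersetCard K) :
    P.real {x | (fun j => ε j x) = signVector s ∧ S x = T} =
      ((2 : ℝ) ^ W * W.choose K)⁻¹ := by
  have h1 : P ((fun x j => ε j x) ⁻¹' {signVector s}) = (2 ^ W : ENNReal)⁻¹ := by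
    have e1 : (fun x j => ε j x) ⁻¹' {signVector s} =
        ⋂ j ∈ (Finset.univ : Finset (Fin W)), ε j ⁻¹' {signVector s j} := by
      ext x
      simp [funext_iff]
    rw [e1, hind.measure_inter_preimage_eq_mul Finset.univ
      fun j _ => measurableSet_singleton _]
    have e2 : ∀ j, P (ε j ⁻¹' {signVector s j}) = (2 : ENNReal)⁻¹ := fun j => by
      have hj := hε j
      rw [rademacherLaw_eq] at hj
      rw [measure_preimage_singleton_of_hasLaw_uniformOn hj, Finset.card_pair (by norm_num)]
      · norm_num
      · rcases Int.units_eq_one_or (s j) with h | h <;> simp [signVector, h]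
    simp only [e2, Finset.prod_const, Finset.card_univ, Fintype.card_fin, ENNReal.inv_pow]
  have h2 : P (S ⁻¹' {T}) = (W.choose K : ENNReal)⁻¹ := by
    rw [uniformSubsetLaw_eq] at hS
    rw [measure_preimage_singleton_of_hasLaw_uniformOn hS hT, Finset.card_powersetCard,
      Finset.card_univ, card_freq]
  have h3 : {x | (fun j => ε j x) = signVector s ∧ S x = T} =
      (fun x j => ε j x) ⁻¹' {signVector s} ∩ S ⁻¹' {T} := rfl
  rw [h3, measureReal_def, hεS.measure_inter_preimage_eq_mul _ _ (measurableSet_singleton _)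
    (measurableSet_singleton _), h1, h2]
  simp [ENNReal.toReal_mul, mul_comm]

/-- The probability of an event depending on independent random signs and an independent uniform
`K`-set is at most the proportion of favourable configurations. No measurability of the event is
needed, as almost surely only finitely many configurations occur. -/
lemma measureReal_le_sum_card [IsProbabilityMeasure P] (hε : ∀ j, HasLaw (ε j) rademacherLaw P)
    (hind : iIndepFun ε P) (hS : HasLaw S (uniformSubsetLaw W K) P)
    (hεS : IndepFun (fun x j => ε j x) S P) (bad : (Fin W → ℝ) → Finset (Freq W) → Prop)
    [∀ e, DecidablePred (bad e)] :
    P.real {x | bad (fun j => ε j x) (S x)} ≤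
      (∑ s : Fin W → ℤˣ, ((((Finset.univ : Finset (Freq W)).powersetCard K).filter
        fun T => bad (signVector s) T).card : ℝ)) * ((2 : ℝ) ^ W * W.choose K)⁻¹ := by
  have hsign : ∀ᵐ x ∂P, ∃ s : Fin W → ℤˣ, (fun j => ε j x) = signVector s := by
    have h1 : ∀ᵐ x ∂P, ∀ j, ε j x ∈ ({1, -1} : Finset ℝ) := ae_all_iff.2 fun j => by
      have hj := hε j
      rw [rademacherLaw_eq] at hj
      exact ae_mem_of_hasLaw_uniformOn hj
    filter_upwards [h1] with x hx
    have h2 : ∀ j, ∃ u : ℤˣ, ε j x = ((u : ℤ) : ℝ) := fun j => by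
      rcases Finset.mem_insert.1 (hx j) with h | h
      · exact ⟨1, by simp [h]⟩
      · exact ⟨-1, by simp [Finset.mem_singleton.1 h]⟩
    choose s hs using h2
    exact ⟨s, funext hs⟩
  have hset : ∀ᵐ x ∂P, S x ∈ (Finset.univ : Finset (Freq W)).powersetCard K := by
    rw [uniformSubsetLaw_eq] at hS
    exact ae_mem_of_hasLaw_uniformOn hS
  have hsub : {x | bad (fun j => ε j x) (S x)} ≤ᵐ[P]
      ⋃ s ∈ (Finset.univ : Finset (Fin W → ℤˣ)),
        ⋃ T ∈ ((Finset.univ : Finset (Freq W)).powersetCard K).filter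
          fun T => bad (signVector s) T,
        {x | (fun j => ε j x) = signVector s ∧ S x = T} := by
    filter_upwards [hsign, hset] with x hx1 hx2 hx
    obtain ⟨s, hs⟩ := hx1
    have hx' : bad (fun j => ε j x) (S x) := hx
    refine Set.mem_iUnion₂.2 ⟨s, Finset.mem_univ s, Set.mem_iUnion₂.2 ⟨S x,
      Finset.mem_filter.2 ⟨hx2, by rw [← hs]; exact hx'⟩, hs, rfl⟩⟩
  calc _ ≤ P.real (⋃ s ∈ (Finset.univ : Finset (Fin W → ℤˣ)),
        ⋃ T ∈ ((Finset.univ : Finset (Freq W)).powersetCard K).filter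
          fun T => bad (signVector s) T,
        {x | (fun j => ε j x) = signVector s ∧ S x = T}) :=
        ENNReal.toReal_mono (measure_ne_top _ _) (measure_mono_ae hsub)
    _ ≤ ∑ s : Fin W → ℤˣ, ∑ T ∈ ((Finset.univ : Finset (Freq W)).powersetCard K).filter
          fun T => bad (signVector s) T,
        P.real {x | (fun j => ε j x) = signVector s ∧ S x = T} :=
        (measureReal_biUnion_finset_le _ _).trans
          (Finset.sum_le_sum fun s _ => measureReal_biUnion_finset_le _ _)
    _ = _ := by
        rw [Finset.sum_mul]
        refine Finset.sum_congr rfl fun s _ => ?_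
        rw [Finset.sum_congr rfl fun T hT => measure_signs_inter_set_eq hε hind hS hεS s
          (Finset.mem_filter.1 hT).1, Finset.sum_const, nsmul_eq_mul]

end Transfer

theorem theorem5 :
    ∃ C : ℝ, 0 < C ∧
      ∀ (W R K : ℕ), 0 < W → R ∣ W → K ≤ W →
        C * ((K : ℝ) * Real.log W + Real.log W ^ 3) ≤ (R : ℝ) →
        ∀ {𝒳 : Type*} [MeasurableSpace 𝒳] (P : Measure 𝒳) [IsProbabilityMeasure P]
          (ε : Fin W → 𝒳 → ℝ) (S : 𝒳 → Finset (Freq W)),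
          (∀ j, HasLaw (ε j) rademacherLaw P) →
          iIndepFun ε P →
          HasLaw S (uniformSubsetLaw W K) P →
          IndepFun (fun x j => ε j x) S P →
          P.real {x | (0.5 : ℝ) ≤
            ‖(columnSubmatrix (demodulatorMatrix R fun j => ε j x) (S x))ᴴ *
                columnSubmatrix (demodulatorMatrix R fun j => ε j x) (S x) - 1‖} ≤
            3 * (W : ℝ)⁻¹ := by
  -- The factor `8` allows for replacing `log W` by the integer `⌈log W⌉ ≤ 2 log W`.
  refine ⟨8 * (512 * 81 * 122880), by norm_num, ?_⟩
  intro W R K hW0 hRW hKW hR 𝒳 _ P _ ε S hε hind hS hεS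
  have hWpos : (0 : ℝ) < W := by exact_mod_cast hW0
  by_cases hW3 : W ≤ 3
  · -- For `W ≤ 3` the bound is at least `1`.
    refine measureReal_le_one.trans ?_
    rw [← div_eq_mul_inv, le_div_iff₀ hWpos, one_mul]
    exact_mod_cast hW3
  obtain ⟨B, hW⟩ := hRW
  have hRpos : 0 < R := Nat.pos_of_ne_zero fun h => by simp [h] at hW; omega
  have hBpos : 0 < B := Nat.pos_of_ne_zero fun h => by simp [h] at hW; omega
  have hlog : 1 ≤ Real.log W := by
    rw [Real.le_log_iff_exp_le hWpos]
    have h1 := Real.exp_one_lt_d9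
    have h2 : (4 : ℝ) ≤ W := by exact_mod_cast (by omega : 4 ≤ W)
    linarith
  set p := ⌈Real.log W⌉₊ with hp
  have hp1 : Real.log W ≤ p := Nat.le_ceil _
  have hp2 : (p : ℝ) ≤ 2 * Real.log W := by
    have := Nat.ceil_lt_add_one (zero_le_one.trans hlog)
    linarith
  have hp0 : p ≠ 0 := by
    intro h
    rw [h, Nat.cast_zero] at hp1
    linarith
  have hWp : (W : ℝ) ≤ Real.exp p := by
    rw [← Real.log_le_iff_le_exp hWpos]
    exact hp1
  have hRK : (512 * 81 * 122880 : ℝ) * (K * p + p ^ 3) ≤ R := by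
    refine le_trans ?_ hR
    have h1 : (p : ℝ) ^ 3 ≤ (2 * Real.log W) ^ 3 := pow_le_pow_left₀ (Nat.cast_nonneg p) hp2 3
    have h2 : (K : ℝ) * p ≤ K * (2 * Real.log W) :=
      mul_le_mul_of_nonneg_left hp2 (Nat.cast_nonneg K)
    have h3 : 0 ≤ (K : ℝ) * Real.log W := mul_nonneg (Nat.cast_nonneg K) (by linarith)
    rw [mul_pow] at h1
    linarith
  have hchoose : (0 : ℝ) < W.choose K := by exact_mod_cast Nat.choose_pos hKW
  classical
  have hprob := measureReal_le_sum_card hε hind hS hεS fun e T => (0.5 : ℝ) ≤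
    ‖(columnSubmatrix (demodulatorMatrix R e) T)ᴴ *
      columnSubmatrix (demodulatorMatrix R e) T - 1‖
  have hcount := sum_card_ill_conditioned_le hRpos hBpos hW (by omega) hp0 hWp hRK
  refine hprob.trans ?_
  rw [← div_eq_mul_inv, div_le_iff₀ (by positivity)]
  have hinv : 2 * (W : ℝ)⁻¹ ≤ 3 * (W : ℝ)⁻¹ := by
    have : 0 < (W : ℝ)⁻¹ := by positivity
    linarith
  calc _ ≤ (2 : ℝ) ^ W * W.choose K * (2 * (W : ℝ)⁻¹) := by convert hcount
    _ ≤ (2 : ℝ) ^ W * W.choose K * (3 * (W : ℝ)⁻¹) := by gcongr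
    _ = _ := by ring
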